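/- **Theorem 4.1.** Let $\phi:\mathbb R\to\mathbb R$ be measurable and controllable, i.e. $|\phi(t)|\le Ce^{c|t|}$ for all $t\in\mathbb R$, for some constants $C,c>0$. Fix $\sigma_u,\sigma_w,\sigma_v>0$, dimensions $n_{in},n_{out}$ and a depth $L\ge 2$. For each width $n$ let $U\in\mathbb R^{n_{in}\times n}$, $W\in\mathbb R^{n\times n}$, $V\in\mathbb R^{n\times n_{out}}$ have independent entries $$U_{ij}\sim\mathcal N(0,\sigma_u^2/n_{in}),\qquad W_{ij}\sim\mathcal N(0,\sigma_w^2/n),\qquad V_{ij}\sim\mathcal N(0,\sigma_v^2/n),$$ all jointly independent. For $x\in\mathbb R^{n_{in}}$ put $h^1(x)=\phi(U^Tx)$ and $h^{\ell}(x)=\phi(W^Th^{\ell-1}(x)+U^Tx)$ for $2\le\ell\le L-1$ ($\phi$ acting entrywise), and let $f^L_\theta(x)=V^Th^{L-1}(x)\in\mathbb R^{n_{out}}$, with coordinates $f^L_{\theta,k}(x)$. Define, for all $x,x'\in\mathbb R^{n_{in}}$, $$\Sigma^1(x,x')=\sigma_u^2\langle x,x'\rangle/n_{in},\qquad \Sigma^2(x,x')=\sigma_w^2\,\mathbb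 E\,\phi(z^1(x))\phi(z^1(x')),$$ $$\Sigma^{\ell+1}(x,x')=\sigma_w^2\,\mathbb E\,\phi\big(z^\ell(x)+z^1(x)\big)\phi\big(z^\ell(x')+z^1(x')\big),\qquad 2\le\ell\le L-1,$$ where $(z^1(x),z^1(x'))$ and $(z^\ell(x),z^\ell(x'))$ are independent centered Gaussian vectors with covariances given by $\Sigma^1$ and $\Sigma^\ell$ respectively, i.e. $$\begin{bmatrix} z^1(x)\\ z^\ell(x)\\ z^1(x')\\ z^\ell(x')\end{bmatrix}\sim\mathcal N\left(0,\begin{bmatrix}\Sigma^1(x,x)&0&\Sigma^1(x,x')&0\\0&\Sigma^\ell(x,x)&0&\Sigma^\ell(x,x')\\ \Sigma^1(x',x)&0&\Sigma^1(x',x')&0\\0&\Sigma^\ell(x',x)&0&\Sigma^\ell(x',x')\end{bmatrix}\right).$$ Then this recursion is well defined (all covariance matrices in it are positive semidefinite and all expectations are absolutely convergent), and as $n\to\infty$ the output functions $f^L_{\theta,k}$, $1\le k\le n_{out}$, converge jointly in distribution, in the sense of finite-dimensional distributions, to independent centered Gaussian processes, each with covariance function $(\sigma_v^2/\sigma_w^2)\,\Sigma^L$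 (which is $\Sigma^L$ when $\sigma_v=\sigma_w$). That is, for all finitely many inputs $x_1,\dots,x_m\in\mathbb R^{n_{in}}$, the random vector $\big(f^L_{\theta,k}(x_i)\big)_{k\le n_{out},\,i\le m}$ converges in distribution to the centered Gaussian vector with covariance matrix $\big(\mathbf 1_{\{k=k'\}}(\sigma_v^2/\sigma_w^2)\Sigma^L(x_i,x_{i'})\big)_{(k,i),(k',i')}$, which is positive semidefinite. -/

import Mathlib

open MeasureTheory ProbabilityTheory Filter Matrix

namespace InputInjectionNet

/-- `φ : ℝ → ℝ` is controllable: it is dominated by `C * exp (c * |x|)` for some `C, c > 0`. -/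
def Controllable (φ : ℝ → ℝ) : Prop :=
  ∃ C c : ℝ, 0 < C ∧ 0 < c ∧ ∀ x : ℝ, |φ x| ≤ C * Real.exp (c * |x|)

/-- The post-activations `h^ℓ(x)` of the network with input injection and shared weights:
`h^1(x) = φ(Uᵀ x)` and `h^(ℓ+1)(x) = φ(Wᵀ h^ℓ(x) + Uᵀ x)` for `ℓ ≥ 1` (with `h^0(x) = 0`);
`φ` acts entrywise. -/
def postActivation (φ : ℝ → ℝ) {nin n : ℕ}
    (U : Matrix (Fin nin) (Fin n) ℝ) (W : Matrix (Fin n) (Fin n) ℝ)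
    (x : EuclideanSpace ℝ (Fin nin)) : ℕ → Fin n → ℝ
  | 0 => 0
  | 1 => fun i => φ ((Uᵀ *ᵥ x.ofLp) i)
  | ℓ + 2 => fun i => φ ((Wᵀ *ᵥ postActivation φ U W x (ℓ + 1)) i + (Uᵀ *ᵥ x.ofLp) i)

/-- The depth-`L` network `f^L(x) = Vᵀ h^(L-1)(x)`, used for `L ≥ 2`. -/
def output (φ : ℝ → ℝ) {nin n nout : ℕ}
    (U : Matrix (Fin nin) (Fin n) ℝ) (W : Matrix (Fin n) (Fin n) ℝ)
    (V : Matrix (Fin n) (Fin nout) ℝ) (L : ℕ) (x : EuclideanSpace ℝ (Fin nin)) :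
    Fin nout → ℝ :=
  Vᵀ *ᵥ postActivation φ U W x (L - 1)

/-- All the entries of the three weight matrices, as one family of random variables. -/
def weightEntry {Ω : Type*} {nin n nout : ℕ}
    (U : Ω → Matrix (Fin nin) (Fin n) ℝ) (W : Ω → Matrix (Fin n) (Fin n) ℝ)
    (V : Ω → Matrix (Fin n) (Fin nout) ℝ) :
    (Fin nin × Fin n) ⊕ (Fin n × Fin n) ⊕ (Fin n × Fin nout) → Ω → ℝ
  | .inl p => fun ω => U ω p.1 p.2
  | .inr (.inl p) => fun ω => W ω p.1 p.2
  | .inr (.inr p) => fun ω => V ω p.1 p.2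

/-- Random initialization: all weights are independent, with
`U i j ∼ N(0, σu² / nin)`, `W i j ∼ N(0, σw² / n)` and `V i j ∼ N(0, σv² / n)`. -/
structure RandomInit {Ω : Type*} [MeasurableSpace Ω] (P : Measure Ω) (σu σw σv : ℝ)
    {nin n nout : ℕ}
    (U : Ω → Matrix (Fin nin) (Fin n) ℝ) (W : Ω → Matrix (Fin n) (Fin n) ℝ)
    (V : Ω → Matrix (Fin n) (Fin nout) ℝ) : Prop where
  law_U : ∀ i j, HasLaw (fun ω => U ω i j) (gaussianReal 0 (σu ^ 2 / nin).toNNReal) P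
  law_W : ∀ i j, HasLaw (fun ω => W ω i j) (gaussianReal 0 (σw ^ 2 / n).toNNReal) P
  law_V : ∀ i j, HasLaw (fun ω => V ω i j) (gaussianReal 0 (σv ^ 2 / n).toNNReal) P
  indep : iIndepFun (weightEntry U W V) P

/-- `Σ^1(x, x') = σu² ⟨x, x'⟩ / nin`. -/
noncomputable def inputKernel (σu : ℝ) {nin : ℕ} (x x' : EuclideanSpace ℝ (Fin nin)) : ℝ :=
  σu ^ 2 * inner ℝ x x' / nin

/-- Covariance matrix of `(z(x), z(x'))` when `z` has covariance function `K`. -/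
def pairCov {X : Type*} (K : X → X → ℝ) (x x' : X) : Matrix (Fin 2) (Fin 2) ℝ :=
  !![K x x, K x x';
     K x' x, K x' x']

/-- Covariance matrix of `(z¹(x), z(x), z¹(x'), z(x'))` when `z¹` and `z` have covariance
functions `K₁` and `K` and are uncorrelated. -/
def quadCov {X : Type*} (K₁ K : X → X → ℝ) (x x' : X) : Matrix (Fin 4) (Fin 4) ℝ :=
  !![K₁ x x, 0, K₁ x x', 0;
     0, K x x, 0, K x x';
     K₁ x' x, 0, K₁ x' x', 0;
     0, K x' x, 0, K x' x']

/-- The covariance functions `Σ^ℓ`, `ℓ ≥ 1` (the value at `ℓ = 0` is not used). -/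
noncomputable def kernel (φ : ℝ → ℝ) (σu σw : ℝ) {nin : ℕ} :
    ℕ → EuclideanSpace ℝ (Fin nin) → EuclideanSpace ℝ (Fin nin) → ℝ
  | 0 => fun _ _ => 0
  | 1 => inputKernel σu
  | 2 => fun x x' => σw ^ 2 *
      ∫ z, φ (z 0) * φ (z 1) ∂(multivariateGaussian 0 (pairCov (inputKernel σu) x x'))
  | ℓ + 3 => fun x x' => σw ^ 2 *
      ∫ z, φ (z 1 + z 0) * φ (z 3 + z 2)
        ∂(multivariateGaussian 0
          (quadCov (inputKernel σu) (kernel φ σu σw (ℓ + 2)) x x'))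

/-- The values `f_k(x_i)`, for all output coordinates `k` and finitely many inputs `x_i`,
as one Euclidean vector. -/
noncomputable def outputVector (φ : ℝ → ℝ) {nin n nout m : ℕ}
    (U : Matrix (Fin nin) (Fin n) ℝ) (W : Matrix (Fin n) (Fin n) ℝ)
    (V : Matrix (Fin n) (Fin nout) ℝ) (L : ℕ) (x : Fin m → EuclideanSpace ℝ (Fin nin)) :
    EuclideanSpace ℝ (Fin nout × Fin m) :=
  WithLp.toLp 2 fun p => output φ U W V L (x p.2) p.1

/-- Covariance matrix of `(z_k(x_i))` over pairs `(k, i)`, for independent centered processes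
`z_k`, all with covariance function `K`. -/
def iidCov {X : Type*} (K : X → X → ℝ) {nout m : ℕ} (x : Fin m → X) :
    Matrix (Fin nout × Fin m) (Fin nout × Fin m) ℝ :=
  fun p q => if p.1 = q.1 then K (x p.2) (x q.2) else 0

end InputInjectionNet

/-! The difficulty is that the same `W` is used in every layer, so the layers cannot be treated one
after the other by conditioning on independent weights. What replaces this is Gaussian conditioning:
once the vectors `Wᵀ f₁, …, Wᵀ f_d` are known, `W` is still distributed like `Π W + (1 - Π) W'`,
where `Π` is the orthogonal projection onto the span of the `f_j` and `W'` is a fresh independent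
copy.

A `Stage` records such a situation. Each neuron carries a state made of its input weights `u` and
the values `γ_j = (Wᵀ f_j)_i`, where each `f_j` is a function of the states that depends only on
earlier coordinates. In the limit law `μ` all these coordinates are independent centered Gaussians
and the `f_j` are orthonormal in `L²(μ)`. Empirical averages over neurons converge in probability to
`μ`-integrals. To adjoin a further orthonormal `f₀` (`Stage.extend`), regress `f₀` on the `f_j`. By
the law of large numbers the empirical Gram matrix tends to the identity and the cross terms to
zero, so given the states the new coordinate is nearly centered and its variance is nearly `vw`
(`Stage.exists_condMean_bound`). A conditional Chebyshev bound then passes the law of large numbers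
on to the enlarged state (`LLN.prod_gaussian`).

Since `φ` is merely measurable, weak convergence is not enough. Conditional Gaussian laws are
compared through an exponentially weighted `L¹` distance of densities
(`exists_abs_integral_gaussianReal_sub_le`), which requires a nondegenerate limit variance.
Orthonormalisation guarantees this even when the kernels are degenerate: a function already in the
span up to a null set is not adjoined, and `AvoidsNull` upgrades the almost sure identity to all
neurons with high probability (`Stage.exists_extension_span`).

By induction on depth the post-activations are functions of the states of a suitable stage, and
orthonormality identifies `Σ^ℓ` with a Gram matrix (`exists_represents`). This also gives positive
semidefiniteness. Finally, the output is Gaussian given the hidden weights, with covariance an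
empirical average. Its characteristic function converges by bounded convergence, and Lévy's theorem
concludes. -/

namespace InputInjectionNet

open scoped NNReal ENNReal Topology

/-! ### Convergence in probability as convergence along a filter. -/

section HighProbability

variable {Ω : ℕ → Type*} [∀ n, MeasurableSpace (Ω n)]

/-- The filter of families of events whose probability tends to one. Convergence in probability
of a sequence `X n : Ω n → ℝ` to a constant is convergence along this filter. -/
def highProb (P : ∀ n, Measure (Ω n)) : Filter (Σ n, Ω n) where
  sets := {S | Tendsto (fun n => P n {ω | (⟨n, ω⟩ : Σ n, Ω n) ∉ S}) atTop (𝓝 0)}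
  univ_sets := by simp
  sets_of_superset := by
    intro S T hS hST
    refine tendsto_of_tendsto_of_tendsto_of_le_of_le tendsto_const_nhds hS
      (fun _ => zero_le) (fun n => measure_mono ?_)
    intro ω hω h
    exact hω (hST h)
  inter_sets := by
    intro S T hS hT
    have h := Tendsto.add hS hT
    rw [add_zero] at h
    refine tendsto_of_tendsto_of_tendsto_of_le_of_le tendsto_const_nhds h
      (fun _ => zero_le) (fun n => ?_)
    refine le_trans (measure_mono ?_) (measure_union_le _ _)
    intro ω hω
    simp only [Set.mem_ofPred_eq, Set.mem_inter_iff, Set.mem_union] at hω ⊢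
    tauto

lemma eventually_highProb {P : ∀ n, Measure (Ω n)} {p : (Σ n, Ω n) → Prop} :
    (∀ᶠ x in highProb P, p x) ↔ Tendsto (fun n => P n {ω | ¬ p ⟨n, ω⟩}) atTop (𝓝 0) :=
  Iff.rfl

/-- The exceptional event is empty once the width is at least `N`. This allows deterministic
asymptotics in the width to be mixed with convergence in probability. -/
lemma tendsto_fst_highProb (P : ∀ n, Measure (Ω n)) :
    Tendsto Sigma.fst (highProb P) atTop := by
  rw [tendsto_atTop]
  intro N
  rw [eventually_highProb]
  refine tendsto_const_nhds.congr' ?_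
  filter_upwards [eventually_ge_atTop N] with n hn
  simp [hn]

lemma eventually_highProb_of_forall_ae {P : ∀ n, Measure (Ω n)} {p : (Σ n, Ω n) → Prop}
    (h : ∀ n, ∀ᵐ ω ∂(P n), p ⟨n, ω⟩) : ∀ᶠ x in highProb P, p x := by
  rw [eventually_highProb]
  simp only [ae_iff] at h
  simp [h]

/-- Bounded convergence along `highProb`. -/
lemma tendsto_lintegral_of_highProb {P : ∀ n, Measure (Ω n)} [∀ n, IsProbabilityMeasure (P n)]
    {X : ∀ n, Ω n → ℝ≥0∞} (hX : ∀ n ω, X n ω ≤ 1)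
    (h : Tendsto (fun p : Σ n, Ω n => X p.1 p.2) (highProb P) (𝓝 0)) :
    Tendsto (fun n => ∫⁻ ω, X n ω ∂(P n)) atTop (𝓝 0) := by
  rw [ENNReal.tendsto_nhds_zero]
  intro ε hε
  have hε2 : 0 < ε / 2 := ENNReal.half_pos hε.ne'
  have h1 := (ENNReal.tendsto_nhds_zero.1 h) (ε / 2) hε2
  rw [eventually_highProb] at h1
  filter_upwards [(ENNReal.tendsto_nhds_zero.1 h1) (ε / 2) hε2] with n hn
  calc ∫⁻ ω, X n ω ∂(P n)
      ≤ ∫⁻ ω, (ε / 2 + Set.indicator {ω | ¬ X n ω ≤ ε / 2} 1 ω) ∂(P n) := by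
        refine lintegral_mono fun ω => ?_
        by_cases hω : X n ω ≤ ε / 2
        · exact le_trans hω le_self_add
        · have : ω ∈ {ω | ¬ X n ω ≤ ε / 2} := hω
          rw [Set.indicator_of_mem this]
          exact le_trans (hX n ω) le_add_self
    _ = ε / 2 + ∫⁻ ω, Set.indicator {ω | ¬ X n ω ≤ ε / 2} 1 ω ∂(P n) := by
        rw [lintegral_add_left measurable_const]; simp
    _ ≤ ε / 2 + ε / 2 := by
        gcongr
        exact le_trans (lintegral_indicator_one_le _) hn
    _ = ε := ENNReal.add_halves ε

/-- Bounded convergence along `highProb`, for complex-valued functions. -/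
lemma tendsto_integral_of_highProb {P : ∀ n, Measure (Ω n)} [∀ n, IsProbabilityMeasure (P n)]
    {X : ∀ n, Ω n → ℂ} (hXm : ∀ n, Measurable (X n)) (hX : ∀ n ω, ‖X n ω‖ ≤ 1) {c : ℂ}
    (hc : ‖c‖ ≤ 1)
    (h : Tendsto (fun p : Σ n, Ω n => X p.1 p.2) (highProb P) (𝓝 c)) :
    Tendsto (fun n => ∫ ω, X n ω ∂(P n)) atTop (𝓝 c) := by
  rw [tendsto_iff_norm_sub_tendsto_zero]
  have hint : ∀ n, Integrable (X n) (P n) := fun n =>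
    (integrable_const (1 : ℝ)).mono' (hXm n).aestronglyMeasurable (ae_of_all _ (hX n))
  -- Halving the distance keeps it below one, as the bounded convergence lemma requires.
  have h0 : Tendsto (fun n => ∫⁻ ω, ENNReal.ofReal (‖X n ω - c‖ / 2) ∂(P n)) atTop (𝓝 0) := by
    apply tendsto_lintegral_of_highProb
    · intro n ω
      rw [ENNReal.ofReal_le_one]
      have := norm_sub_le (X n ω) c
      linarith [hX n ω]
    · have h1 := (tendsto_iff_norm_sub_tendsto_zero.1 h).div_const 2
      have := ENNReal.tendsto_ofReal h1
      simpa using this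
  have h1 : Tendsto (fun n => 2 * (∫⁻ ω, ENNReal.ofReal (‖X n ω - c‖ / 2) ∂(P n)).toReal) atTop
      (𝓝 0) := by
    have := ((ENNReal.tendsto_toReal ENNReal.zero_ne_top).comp h0).const_mul 2
    simpa using this
  refine squeeze_zero (fun _ => norm_nonneg _) (fun n => ?_) h1
  rw [← integral_toReal (by fun_prop) (ae_of_all _ fun _ => ENNReal.ofReal_lt_top)]
  calc ‖∫ ω, X n ω ∂(P n) - c‖ = ‖∫ ω, (X n ω - c) ∂(P n)‖ := by
        rw [integral_sub (hint n) (integrable_const c)]; simp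
    _ ≤ ∫ ω, ‖X n ω - c‖ ∂(P n) := norm_integral_le_integral_norm _
    _ = _ := by
        rw [← integral_const_mul]
        congr 1; ext ω
        rw [ENNReal.toReal_ofReal (by positivity)]; ring

end HighProbability

/-! ### Isotropic Gaussian vectors and their linear images. -/

section GaussianProduct

open Complex

/-- Centered Gaussian measure on `ι → ℝ` with covariance `v • 1`. -/
noncomputable def isoGaussian (ι : Type*) [Fintype ι] (v : ℝ≥0) : Measure (ι → ℝ) :=
  Measure.pi fun _ => gaussianReal 0 v

instance (ι : Type*) [Fintype ι] (v : ℝ≥0) : IsProbabilityMeasure (isoGaussian ι v) := by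
  unfold isoGaussian; infer_instance

lemma integral_cexp_sum_isoGaussian {ι : Type*} [Fintype ι] (v : ℝ≥0) (t : ι → ℝ) :
    ∫ w, cexp (((∑ i, t i * w i : ℝ) : ℂ) * I) ∂(isoGaussian ι v)
      = cexp (-((v * ∑ i, t i ^ 2 : ℝ) : ℂ) / 2) := by
  unfold isoGaussian
  have h1 : ∀ w : ι → ℝ, cexp (((∑ i, t i * w i : ℝ) : ℂ) * I)
      = ∏ i, cexp ((t i : ℂ) * (w i : ℂ) * I) := by
    intro w
    rw [← Complex.exp_sum, ← Finset.sum_mul]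
    push_cast
    rfl
  simp_rw [h1]
  rw [integral_fintype_prod_eq_prod (f := fun i (x : ℝ) => cexp ((t i : ℂ) * (x : ℂ) * I))]
  simp_rw [← charFun_apply_real, charFun_gaussianReal]
  rw [← Complex.exp_sum]
  congr 1
  push_cast
  rw [Finset.mul_sum, ← Finset.sum_neg_distrib, Finset.sum_div]
  refine Finset.sum_congr rfl fun i _ => ?_
  ring

/-- The function space carries no inner product, so uniqueness comes from the characteristic
function on the dual, whose elements are written in coordinates. -/
lemma measure_ext_of_integral_cexp {ι : Type*} [Fintype ι] {μ ν : Measure (ι → ℝ)}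
    [IsFiniteMeasure μ] [IsFiniteMeasure ν]
    (h : ∀ t : ι → ℝ, ∫ w, cexp (((∑ i, t i * w i : ℝ) : ℂ) * I) ∂μ
      = ∫ w, cexp (((∑ i, t i * w i : ℝ) : ℂ) * I) ∂ν) : μ = ν := by
  classical
  apply Measure.ext_of_charFunDual
  ext L
  rw [charFunDual_apply, charFunDual_apply]
  have hL : ∀ w, L w = ∑ i, L (Pi.single i 1) * w i := by
    intro w
    have := LinearMap.pi_apply_eq_sum_univ (L : (ι → ℝ) →ₗ[ℝ] ℝ) w
    simp only [ContinuousLinearMap.coe_coe, smul_eq_mul] at this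
    rw [this]
    refine Finset.sum_congr rfl fun i _ => ?_
    rw [mul_comm]
    congr 2
    ext j
    by_cases hij : i = j
    · subst hij; simp
    · simp [hij, Ne.symm hij]
  have hL' : (fun w => cexp ((L w : ℂ) * I))
      = fun w => cexp (((∑ i, L (Pi.single i 1) * w i : ℝ) : ℂ) * I) :=
    funext fun w => by rw [hL w]
  rw [hL']
  exact h _

/-- Gaussian law of the linear images of two independent isotropic Gaussian vectors. -/
lemma map_isoGaussian_eq {ι κ : Type*} [Fintype ι] [Fintype κ] (v v' : ℝ≥0)
    (f : (ι → ℝ) → κ → ℝ) (hf : Measurable f) (g : (κ → ℝ) → ι → ℝ)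
    (hfg : ∀ w t, ∑ k, t k * f w k = ∑ i, g t i * w i)
    (hg : ∀ t, v * ∑ i, g t i ^ 2 = v' * ∑ k, t k ^ 2) :
    (isoGaussian ι v).map f = isoGaussian κ v' := by
  have := Measure.isProbabilityMeasure_map (μ := isoGaussian ι v) hf.aemeasurable
  apply measure_ext_of_integral_cexp
  intro t
  rw [integral_map hf.aemeasurable (Measurable.aestronglyMeasurable (by fun_prop))]
  simp_rw [hfg]
  rw [integral_cexp_sum_isoGaussian, integral_cexp_sum_isoGaussian, hg]

/-- Here `g` and `g'` are the adjoints of the two components of `f`. By `hg` the joint adjoint is an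
isometry, so the characteristic function is preserved. -/
lemma map_prod_isoGaussian_eq {ι : Type*} [Fintype ι] (v : ℝ≥0)
    (f : (ι → ℝ) × (ι → ℝ) → ι → ℝ) (hf : Measurable f) (g g' : (ι → ℝ) → ι → ℝ)
    (hfg : ∀ w w' t, ∑ k, t k * f (w, w') k = ∑ i, g t i * w i + ∑ i, g' t i * w' i)
    (hg : ∀ t, ∑ i, g t i ^ 2 + ∑ i, g' t i ^ 2 = ∑ k, t k ^ 2) :
    ((isoGaussian ι v).prod (isoGaussian ι v)).map f = isoGaussian ι v := by
  have := Measure.isProbabilityMeasure_map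
    (μ := (isoGaussian ι v).prod (isoGaussian ι v)) hf.aemeasurable
  apply measure_ext_of_integral_cexp
  intro t
  rw [integral_map hf.aemeasurable (Measurable.aestronglyMeasurable (by fun_prop))]
  have h1 : ∀ p : (ι → ℝ) × (ι → ℝ), cexp (((∑ i, t i * f p i : ℝ) : ℂ) * I)
      = cexp (((∑ i, g t i * p.1 i : ℝ) : ℂ) * I) * cexp (((∑ i, g' t i * p.2 i : ℝ) : ℂ) * I) := by
    intro p
    rw [← Complex.exp_add, hfg]
    push_cast
    rw [add_mul]
  simp_rw [h1]
  rw [integral_prod_mul (fun w : ι → ℝ => cexp (((∑ i, g t i * w i : ℝ) : ℂ) * I))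
    (fun w : ι → ℝ => cexp (((∑ i, g' t i * w i : ℝ) : ℂ) * I)),
    integral_cexp_sum_isoGaussian, integral_cexp_sum_isoGaussian, integral_cexp_sum_isoGaussian,
    ← Complex.exp_add, ← hg t]
  congr 1
  push_cast
  ring

/-- Translating an isotropic Gaussian vector. -/
lemma map_const_add_isoGaussian {ι : Type*} [Fintype ι] (v : ℝ≥0) (m : ι → ℝ) :
    (isoGaussian ι v).map (fun w => m + w) = Measure.pi fun i => gaussianReal (m i) v := by
  have h := Measure.pi_map_pi (μ := fun _ : ι => gaussianReal 0 v)
    (f := fun i (x : ℝ) => m i + x) (fun i => by fun_prop)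
  simp only [gaussianReal_map_const_add, zero_add] at h
  exact h

end GaussianProduct

/-! ### Chebyshev's inequality for non-identically distributed averages. -/

section Chebyshev

/-- Laws and functions may vary with `i` because, given the states, the neurons are independent but
have different means. The bound uses second moments instead of variances, since these are again
empirical averages. -/
lemma measure_pi_abs_average_sub_ge_le {n : ℕ} {T : Type*} [MeasurableSpace T]
    (ν : Fin n → Measure T) [∀ i, IsProbabilityMeasure (ν i)] (g : Fin n → T → ℝ)
    (hg : ∀ i, MemLp (g i) 2 (ν i)) {ε : ℝ} (hε : 0 < ε) :
    Measure.pi ν {t | ε ≤ |(∑ i, g i (t i)) / n - (∑ i, ∫ x, g i x ∂(ν i)) / n|}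
      ≤ ENNReal.ofReal ((∑ i, ∫ x, g i x ^ 2 ∂(ν i)) / n / (n * ε ^ 2)) := by
  rcases Nat.eq_zero_or_pos n with rfl | hn
  · simp [not_le.2 hε]
  have hn' : (0 : ℝ) < n := by exact_mod_cast hn
  have hmem : ∀ i, MemLp (fun t : Fin n → T => g i (t i)) 2 (Measure.pi ν) := fun i =>
    (hg i).comp_measurePreserving (measurePreserving_eval _ i)
  have hL : MemLp (∑ i, fun t : Fin n → T => g i (t i)) 2 (Measure.pi ν) :=
    memLp_finsetSum' _ fun i _ => hmem i
  have hE : ∫ t, (∑ i, fun t : Fin n → T => g i (t i)) t ∂(Measure.pi ν)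
      = ∑ i, ∫ x, g i x ∂(ν i) := by
    simp only [Finset.sum_apply]
    rw [integral_finsetSum _ fun i _ => (hmem i).integrable one_le_two]
    refine Finset.sum_congr rfl fun i _ => ?_
    have := (measurePreserving_eval ν i).map_eq
    conv_rhs => rw [← this]
    rw [integral_map (measurable_pi_apply i).aemeasurable]
    have h2 := this
    unfold Function.eval at h2
    rw [h2]; exact (hg i).aestronglyMeasurable
  have hC := meas_ge_le_variance_div_sq hL (c := n * ε) (by positivity)
  rw [hE, variance_sum_pi hg] at hC
  refine le_trans (measure_mono ?_) (le_trans hC (ENNReal.ofReal_le_ofReal ?_))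
  · intro t ht
    simp only [Set.mem_ofPred_eq, Finset.sum_apply] at ht ⊢
    rw [← sub_div, abs_div, abs_of_pos hn', le_div_iff₀ hn'] at ht
    linarith
  · have h1 : ∑ i, Var[g i; ν i] ≤ ∑ i, ∫ x, g i x ^ 2 ∂(ν i) :=
      Finset.sum_le_sum fun i _ => by
        simpa using variance_le_expectation_sq (hg i).aestronglyMeasurable
    rw [div_div, div_le_div_iff₀ (by positivity) (by positivity)]
    have h3 : (n : ℝ) * (n * ε ^ 2) = (n * ε) ^ 2 := by ring
    rw [h3]
    gcongr

end Chebyshev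

/-! ### Weighted total-variation continuity of one-dimensional Gaussians. -/

section GaussianReal

lemma exp_mul_abs_le (c x : ℝ) :
    Real.exp (c * |x|) ≤ Real.exp (c * x) + Real.exp (-c * x) := by
  rcases abs_cases x with ⟨h, _⟩ | ⟨h, _⟩ <;> rw [h]
  · linarith [Real.exp_pos (-c * x)]
  · rw [mul_neg, ← neg_mul]; linarith [Real.exp_pos (c * x)]

lemma integrable_exp_mul_abs_gaussianReal (c m : ℝ) (v : ℝ≥0) :
    Integrable (fun x => Real.exp (c * |x|)) (gaussianReal m v) := by
  refine ((integrable_exp_mul_gaussianReal (μ := m) (v := v) c).add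
    (integrable_exp_mul_gaussianReal (μ := m) (v := v) (-c))).mono' (by fun_prop) ?_
  refine ae_of_all _ fun x => ?_
  rw [Real.norm_of_nonneg (Real.exp_pos _).le]
  exact exp_mul_abs_le c x

lemma integral_exp_mul_abs_gaussianReal_le {c : ℝ} (hc : 0 ≤ c) (m : ℝ) (v : ℝ≥0) :
    ∫ x, Real.exp (c * |x|) ∂(gaussianReal m v)
      ≤ 2 * Real.exp (v * c ^ 2 / 2) * Real.exp (c * |m|) := by
  have hm : ∀ t : ℝ, ∫ x, Real.exp (t * x) ∂(gaussianReal m v)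
      = Real.exp (m * t + v * t ^ 2 / 2) := fun t =>
    congrFun (mgf_fun_id_gaussianReal (μ := m) (v := v)) t
  calc ∫ x, Real.exp (c * |x|) ∂(gaussianReal m v)
      ≤ ∫ x, (Real.exp (c * x) + Real.exp (-c * x)) ∂(gaussianReal m v) :=
        integral_mono (integrable_exp_mul_abs_gaussianReal c m v)
          ((integrable_exp_mul_gaussianReal c).add (integrable_exp_mul_gaussianReal (-c)))
          (fun x => exp_mul_abs_le c x)
    _ = Real.exp (m * c + v * c ^ 2 / 2) + Real.exp (m * (-c) + v * (-c) ^ 2 / 2) := by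
        rw [integral_add (integrable_exp_mul_gaussianReal c)
          (integrable_exp_mul_gaussianReal (-c)), hm, hm]
    _ ≤ 2 * Real.exp (v * c ^ 2 / 2) * Real.exp (c * |m|) := by
        rw [mul_assoc, ← Real.exp_add, two_mul]
        have h1 := le_abs_self m
        have h2 := neg_abs_le m
        have h3 : m * c ≤ c * |m| := by nlinarith
        have h4 : m * (-c) ≤ c * |m| := by nlinarith
        rw [neg_sq]
        refine add_le_add (Real.exp_le_exp.2 ?_) (Real.exp_le_exp.2 ?_) <;> linarith

lemma abs_integral_gaussianReal_le {c : ℝ} (hc : 0 ≤ c) (m : ℝ) (v : ℝ≥0) {g : ℝ → ℝ}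
    (hg : ∀ t, |g t| ≤ Real.exp (c * |t|)) :
    |∫ x, g x ∂(gaussianReal m v)| ≤ 2 * Real.exp (v * c ^ 2 / 2) * Real.exp (c * |m|) := by
  rw [← Real.norm_eq_abs]
  exact le_trans (norm_integral_le_of_norm_le (integrable_exp_mul_abs_gaussianReal c m v)
    (ae_of_all _ hg)) (integral_exp_mul_abs_gaussianReal_le hc m v)

lemma integrable_exp_mul_gaussianPDFReal (c m : ℝ) {v : ℝ≥0} (hv : v ≠ 0) :
    Integrable (fun x => Real.exp (c * |x|) * gaussianPDFReal m v x) := by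
  have h := integrable_exp_mul_abs_gaussianReal c m v
  rw [gaussianReal_of_var_ne_zero _ hv, integrable_withDensity_iff_integrable_smul'
    (measurable_gaussianPDF m v) (ae_of_all _ fun _ => gaussianPDF_lt_top)] at h
  refine h.congr (ae_of_all _ fun x => ?_)
  simp [toReal_gaussianPDF, mul_comm]

/-- Every Gaussian density with parameters near `(0, τ)` lies below one multiple of a wider density.
This supplies the dominating function for dominated convergence. -/
lemma gaussianPDFReal_le {τ v : ℝ≥0} (hτ : 0 < τ) (hv : τ / 2 < v) (hv' : v < 2 * τ) {m : ℝ}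
    (hm : |m| < 1) (x : ℝ) :
    gaussianPDFReal m v x ≤ (√(Real.pi * τ))⁻¹ * Real.exp (1 / (4 * τ)) * √(8 * Real.pi * τ)
      * gaussianPDFReal 0 (4 * τ) x := by
  have hτ' : (0 : ℝ) < τ := by exact_mod_cast hτ
  have h1 : (τ : ℝ) / 2 < v := by exact_mod_cast hv
  have h2 : (v : ℝ) < 2 * τ := by exact_mod_cast hv'
  have hv0 : (0 : ℝ) < v := by linarith
  have hpi := Real.pi_pos
  simp only [gaussianPDFReal]
  have e1 : 2 * Real.pi * ((4 * τ : ℝ≥0) : ℝ) = 8 * Real.pi * τ := by push_cast; ring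
  rw [e1]
  have e2 : (√(Real.pi * τ))⁻¹ * Real.exp (1 / (4 * τ)) * √(8 * Real.pi * τ) *
      ((√(8 * Real.pi * τ))⁻¹ * Real.exp (-(x - 0) ^ 2 / (2 * ((4 * τ : ℝ≥0) : ℝ))))
      = (√(Real.pi * τ))⁻¹ * Real.exp (1 / (4 * τ) + -(x - 0) ^ 2 / (2 * ((4 * τ : ℝ≥0) : ℝ))) := by
    rw [Real.exp_add]
    have : √(8 * Real.pi * τ) ≠ 0 := by positivity
    field_simp
  rw [e2]
  have h3 : m ^ 2 ≤ 1 := by rw [← sq_abs]; nlinarith [abs_nonneg m]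
  have h4 : -(x - m) ^ 2 / (2 * v) ≤ 1 / (4 * τ) + -(x - 0) ^ 2 / (2 * ((4 * τ : ℝ≥0) : ℝ)) := by
    have : 1 / (4 * (τ : ℝ)) + -(x - 0) ^ 2 / (2 * ((4 * τ : ℝ≥0) : ℝ))
        = (2 - x ^ 2) / (8 * τ) := by push_cast; field_simp; ring
    rw [this]
    have h5 : -(x - m) ^ 2 / (2 * v) ≤ -(x - m) ^ 2 / (4 * τ) := by
      rw [neg_div, neg_div, neg_le_neg_iff]
      apply div_le_div_of_nonneg_left (sq_nonneg _) (by positivity) (by linarith)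
    refine h5.trans ?_
    rw [div_le_div_iff₀ (by positivity) (by positivity)]
    -- The identity behind this is `2 (x - m)² - x² + 2 = (x - 2m)² + 2 (1 - m²)`.
    nlinarith [mul_nonneg hτ'.le (sq_nonneg (x - 2 * m)), mul_nonneg hτ'.le (sub_nonneg.2 h3)]
  have h6 : √(Real.pi * τ) ≤ √(2 * Real.pi * v) := Real.sqrt_le_sqrt (by nlinarith)
  exact mul_le_mul (inv_anti₀ (by positivity) h6) (Real.exp_le_exp.2 h4) (Real.exp_pos _).le
    (by positivity)

/-- Dominated convergence, using pointwise continuity of the density at a positive variance. The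
absolute value of the density difference makes the estimate uniform over measurable test functions.
-/
lemma tendsto_integral_exp_mul_abs_gaussianPDFReal_sub (c : ℝ) {τ : ℝ≥0} (hτ : 0 < τ) :
    Tendsto (fun p : ℝ × ℝ≥0 => ∫ x, Real.exp (c * |x|) *
      |gaussianPDFReal p.1 p.2 x - gaussianPDFReal 0 τ x|) (𝓝 (0, τ)) (𝓝 0) := by
  suffices h : Tendsto (fun p : ℝ × ℝ≥0 => ∫ x, Real.exp (c * |x|) *
      |gaussianPDFReal p.1 p.2 x - gaussianPDFReal 0 τ x|) (𝓝 (0, τ)) (𝓝 (∫ _ : ℝ, (0 : ℝ))) by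
    simpa using h
  have hev : ∀ᶠ p : ℝ × ℝ≥0 in 𝓝 ((0 : ℝ), τ), |p.1| < 1 ∧ τ / 2 < p.2 ∧ p.2 < 2 * τ := by
    have hopen : IsOpen {p : ℝ × ℝ≥0 | |p.1| < 1 ∧ τ / 2 < p.2 ∧ p.2 < 2 * τ} :=
      (isOpen_lt (f := fun p : ℝ × ℝ≥0 => |p.1|) (by fun_prop) continuous_const).inter
        ((isOpen_lt (g := fun p : ℝ × ℝ≥0 => p.2) continuous_const (by fun_prop)).inter
          (isOpen_lt (f := fun p : ℝ × ℝ≥0 => p.2) (by fun_prop) continuous_const))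
    refine hopen.mem_nhds ⟨by simp, half_lt_self hτ, ?_⟩
    rw [two_mul]
    exact lt_add_of_pos_right τ hτ
  set K := (√(Real.pi * τ))⁻¹ * Real.exp (1 / (4 * τ)) * √(8 * Real.pi * τ) with hK
  have h4τ : 4 * τ ≠ 0 := by positivity
  have hb : Integrable (fun x => Real.exp (c * |x|) * (K * gaussianPDFReal 0 (4 * τ) x +
      gaussianPDFReal 0 τ x)) := by
    have := ((integrable_exp_mul_gaussianPDFReal c 0 h4τ).const_mul K).add
      (integrable_exp_mul_gaussianPDFReal c 0 hτ.ne')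
    refine this.congr (ae_of_all _ fun x => ?_)
    simp only [Pi.add_apply]; ring
  refine tendsto_integral_filter_of_dominated_convergence _ ?_ ?_ hb ?_
  · refine Eventually.of_forall fun p => ?_
    have h1 := measurable_gaussianPDFReal p.1 p.2
    have h2 := measurable_gaussianPDFReal 0 τ
    exact Measurable.aestronglyMeasurable (by fun_prop)
  · filter_upwards [hev] with p hp
    refine ae_of_all _ fun x => ?_
    rw [norm_mul, Real.norm_of_nonneg (Real.exp_pos _).le, norm_abs_eq_norm, Real.norm_eq_abs]
    gcongr
    refine (abs_sub _ _).trans ?_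
    rw [abs_of_nonneg (gaussianPDFReal_nonneg _ _ _), abs_of_nonneg (gaussianPDFReal_nonneg _ _ _)]
    gcongr
    exact gaussianPDFReal_le hτ hp.2.1 hp.2.2 hp.1 x
  · refine ae_of_all _ fun x => ?_
    have hτ' : (0 : ℝ) < τ := by exact_mod_cast hτ
    have hpi := Real.pi_pos
    have hc : ContinuousAt (fun p : ℝ × ℝ≥0 => gaussianPDFReal p.1 p.2 x) ((0 : ℝ), τ) := by
      simp only [gaussianPDFReal]
      have h1 : √(2 * Real.pi * (((0 : ℝ), τ) : ℝ × ℝ≥0).2) ≠ 0 := by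
        simp only; positivity
      have h2 : (2 : ℝ) * ((((0 : ℝ), τ) : ℝ × ℝ≥0).2 : ℝ) ≠ 0 := by
        simp only; positivity
      exact ContinuousAt.mul (ContinuousAt.inv₀ (by fun_prop) h1)
        (Real.continuous_exp.continuousAt.comp (ContinuousAt.div (by fun_prop) (by fun_prop) h2))
    have h3 := ((hc.tendsto.sub_const (gaussianPDFReal 0 τ x)).abs).const_mul
      (Real.exp (c * |x|))
    simpa using h3

/-- Total-variation type continuity of `gaussianReal m v` at `m = 0`, with exponential weight. -/
lemma exists_abs_integral_gaussianReal_sub_le {c : ℝ} (hc : 0 ≤ c) {τ : ℝ≥0} (hτ : 0 < τ)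
    {δ : ℝ} (hδ : 0 < δ) :
    ∃ r > 0, ∃ K : ℝ, 0 ≤ K ∧ ∀ (m : ℝ) (v : ℝ≥0), dist v τ < r → ∀ g : ℝ → ℝ, Measurable g →
      (∀ t, |g t| ≤ Real.exp (c * |t|)) →
      |∫ x, g x ∂(gaussianReal m v) - ∫ x, g x ∂(gaussianReal 0 τ)|
        ≤ δ + K * |m| * Real.exp (c * |m|) := by
  obtain ⟨r₀, hr₀, hJ⟩ := Metric.tendsto_nhds_nhds.1
    (tendsto_integral_exp_mul_abs_gaussianPDFReal_sub c hτ) δ hδ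
  have hτ' : (0 : ℝ) < τ := by exact_mod_cast hτ
  set r := min r₀ (τ / 2 : ℝ) with hr
  have hrpos : 0 < r := lt_min hr₀ (by positivity)
  set K₁ := 2 * Real.exp ((2 * τ) * c ^ 2 / 2) with hK₁
  -- For `|m| < r` the `L¹` estimate already gives `δ`. For larger means each integral is at most
  -- `K₁ * exp (c * |m|)`, and the factor `|m| / r ≥ 1` turns this into the linear term, whence `2 *
  -- K₁ / r`.
  refine ⟨r, hrpos, 2 * K₁ / r, by positivity, fun m v hv g hgm hg => ?_⟩
  have hv1 : dist v τ < τ / 2 := hv.trans_le (min_le_right _ _)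
  rw [NNReal.dist_eq, abs_lt] at hv1
  have hv0 : v ≠ 0 := by
    rintro rfl
    rw [NNReal.coe_zero] at hv1
    linarith [hv1.1]
  by_cases hm : |m| < r
  · have h1 : |∫ x, g x ∂(gaussianReal m v) - ∫ x, g x ∂(gaussianReal 0 τ)| < δ := by
      have h2 : dist ((m, v) : ℝ × ℝ≥0) (0, τ) < r₀ := by
        rw [Prod.dist_eq]
        refine max_lt ?_ (hv.trans_le (min_le_left _ _))
        simpa using hm.trans_le (min_le_left _ _)
      have h3 := hJ h2
      rw [dist_zero_right] at h3
      refine lt_of_le_of_lt ?_ (lt_of_le_of_lt (Real.le_norm_self _) h3)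
      rw [integral_gaussianReal_eq_integral_smul hv0,
        integral_gaussianReal_eq_integral_smul hτ.ne']
      have hint : ∀ (m : ℝ) {v : ℝ≥0}, v ≠ 0 →
          Integrable (fun x => gaussianPDFReal m v x • g x) := by
        intro m v hv
        refine (integrable_exp_mul_gaussianPDFReal c m hv).mono'
          ((measurable_gaussianPDFReal m v).smul hgm).aestronglyMeasurable
          (ae_of_all _ fun x => ?_)
        rw [norm_smul, Real.norm_of_nonneg (gaussianPDFReal_nonneg _ _ _), mul_comm]
        exact mul_le_mul_of_nonneg_right (hg x) (gaussianPDFReal_nonneg _ _ _)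
      rw [← integral_sub (hint m hv0) (hint 0 hτ.ne')]
      rw [← Real.norm_eq_abs]
      refine norm_integral_le_of_norm_le ?_ (ae_of_all _ fun x => ?_)
      · have := (integrable_exp_mul_gaussianPDFReal c m hv0).sub
          (integrable_exp_mul_gaussianPDFReal c 0 hτ.ne')
        refine this.norm.congr (ae_of_all _ fun x => ?_)
        simp only [Pi.sub_apply]
        rw [← mul_sub, norm_mul, Real.norm_of_nonneg (Real.exp_pos _).le, Real.norm_eq_abs]
      · rw [← sub_smul, norm_smul, mul_comm, Real.norm_eq_abs, Real.norm_eq_abs]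
        exact mul_le_mul_of_nonneg_right (hg x) (abs_nonneg _)
    have : 0 ≤ 2 * K₁ / r * |m| * Real.exp (c * |m|) := by positivity
    linarith
  · push Not at hm
    have hvτ : (v : ℝ) ≤ 2 * τ := by linarith [hv1.2]
    have h1 := abs_integral_gaussianReal_le hc m v hg
    have h2 := abs_integral_gaussianReal_le hc 0 τ hg
    have h3 : Real.exp (v * c ^ 2 / 2) ≤ Real.exp ((2 * τ) * c ^ 2 / 2) := by gcongr
    have h4 : Real.exp (τ * c ^ 2 / 2) ≤ Real.exp ((2 * τ) * c ^ 2 / 2) := by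
      gcongr; linarith
    have h5 : (1 : ℝ) ≤ Real.exp (c * |m|) := Real.one_le_exp (by positivity)
    have h6 : 1 ≤ |m| / r := (one_le_div hrpos).2 hm
    rw [abs_zero, mul_zero, Real.exp_zero, mul_one] at h2
    calc _ ≤ |∫ x, g x ∂(gaussianReal m v)| + |∫ x, g x ∂(gaussianReal 0 τ)| := abs_sub _ _
      _ ≤ K₁ * Real.exp (c * |m|) + K₁ * Real.exp (c * |m|) := by
          gcongr
          · exact h1.trans (by rw [hK₁]; gcongr)
          · refine h2.trans ?_
            rw [hK₁]
            nlinarith [Real.exp_pos ((2 * τ) * c ^ 2 / 2)]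
      _ = 2 * K₁ * 1 * Real.exp (c * |m|) := by ring
      _ ≤ 2 * K₁ * (|m| / r) * Real.exp (c * |m|) := by gcongr
      _ ≤ δ + 2 * K₁ / r * |m| * Real.exp (c * |m|) := by
          have : 2 * K₁ * (|m| / r) = 2 * K₁ / r * |m| := by ring
          rw [this]; linarith

end GaussianReal

/-! ### Functions of exponential growth. -/

section ExpBounded

variable {S : Type*}

/-- `ψ` grows at most exponentially in the weight `ρ`. -/
def ExpBounded (ρ ψ : S → ℝ) : Prop :=
  ∃ C c : ℝ, 0 < C ∧ 0 ≤ c ∧ ∀ q, |ψ q| ≤ C * Real.exp (c * ρ q)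

variable {ρ ψ ψ' : S → ℝ}

lemma expBounded_const (a : ℝ) : ExpBounded ρ fun _ => a := by
  refine ⟨|a| + 1, 0, by positivity, le_rfl, fun q => ?_⟩
  simp

lemma expBounded_exp (c : ℝ) (hc : 0 ≤ c) : ExpBounded ρ fun q => Real.exp (c * ρ q) :=
  ⟨1, c, one_pos, hc, fun q => by rw [abs_of_pos (Real.exp_pos _), one_mul]⟩

lemma ExpBounded.add (hρ : ∀ q, 0 ≤ ρ q) (h : ExpBounded ρ ψ) (h' : ExpBounded ρ ψ') :
    ExpBounded ρ fun q => ψ q + ψ' q := by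
  obtain ⟨C, c, hC, hc, h⟩ := h
  obtain ⟨C', c', hC', hc', h'⟩ := h'
  refine ⟨C + C', c + c', by positivity, by positivity, fun q => ?_⟩
  have := hρ q
  calc |ψ q + ψ' q| ≤ |ψ q| + |ψ' q| := abs_add_le _ _
    _ ≤ C * Real.exp (c * ρ q) + C' * Real.exp (c' * ρ q) := add_le_add (h q) (h' q)
    _ ≤ C * Real.exp ((c + c') * ρ q) + C' * Real.exp ((c + c') * ρ q) := by
        gcongr <;> linarith
    _ = _ := by ring

lemma ExpBounded.mul (h : ExpBounded ρ ψ) (h' : ExpBounded ρ ψ') :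
    ExpBounded ρ fun q => ψ q * ψ' q := by
  obtain ⟨C, c, hC, hc, h⟩ := h
  obtain ⟨C', c', hC', hc', h'⟩ := h'
  refine ⟨C * C', c + c', by positivity, by positivity, fun q => ?_⟩
  rw [abs_mul, add_mul, Real.exp_add]
  calc |ψ q| * |ψ' q| ≤ (C * Real.exp (c * ρ q)) * (C' * Real.exp (c' * ρ q)) :=
        mul_le_mul (h q) (h' q) (abs_nonneg _) (by positivity)
    _ = _ := by ring

lemma ExpBounded.const_mul (h : ExpBounded ρ ψ) (a : ℝ) :
    ExpBounded ρ fun q => a * ψ q :=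
  (expBounded_const a).mul h

lemma ExpBounded.sum (hρ : ∀ q, 0 ≤ ρ q) {ι : Type*} (s : Finset ι) {f : ι → S → ℝ}
    (h : ∀ i, ExpBounded ρ (f i)) : ExpBounded ρ fun q => ∑ i ∈ s, f i q := by
  classical
  induction s using Finset.induction_on with
  | empty => simpa using expBounded_const (ρ := ρ) 0
  | insert a s ha ih =>
    simp_rw [Finset.sum_insert ha]
    exact (h a).add hρ ih

lemma ExpBounded.sub (hρ : ∀ q, 0 ≤ ρ q) (h : ExpBounded ρ ψ) (h' : ExpBounded ρ ψ') :
    ExpBounded ρ fun q => ψ q - ψ' q := by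
  simpa [sub_eq_add_neg] using h.add hρ (h'.const_mul (-1))

lemma ExpBounded.integrable [MeasurableSpace S] {μ : Measure S}
    (hμ : ∀ c, Integrable (fun q => Real.exp (c * ρ q)) μ) (hψ : Measurable ψ)
    (h : ExpBounded ρ ψ) : Integrable ψ μ := by
  obtain ⟨C, c, -, -, h⟩ := h
  exact ((hμ c).const_mul C).mono' hψ.aestronglyMeasurable (ae_of_all _ h)

lemma ExpBounded.memLp_two [MeasurableSpace S] {μ : Measure S}
    (hμ : ∀ c, Integrable (fun q => Real.exp (c * ρ q)) μ) (hψ : Measurable ψ)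
    (h : ExpBounded ρ ψ) : MemLp ψ 2 μ := by
  rw [memLp_two_iff_integrable_sq hψ.aestronglyMeasurable]
  simp_rw [pow_two]
  exact (h.mul h).integrable hμ (hψ.mul hψ)

/-- The weight on `S × ℝ` induced by a weight on `S`. -/
def extWeight (ρ : S → ℝ) (q : S × ℝ) : ℝ := ρ q.1 + |q.2|

lemma extWeight_nonneg (hρ : ∀ q, 0 ≤ ρ q) (q : S × ℝ) : 0 ≤ extWeight ρ q :=
  add_nonneg (hρ _) (abs_nonneg _)

lemma le_extWeight (ρ : S → ℝ) (q : S × ℝ) : ρ q.1 ≤ extWeight ρ q :=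
  le_add_of_nonneg_right (abs_nonneg _)

lemma ExpBounded.comp_fst (h : ExpBounded ρ ψ) :
    ExpBounded (extWeight ρ) fun q : S × ℝ => ψ q.1 := by
  obtain ⟨C, c, hC, hc, h⟩ := h
  refine ⟨C, c, hC, hc, fun q => (h q.1).trans ?_⟩
  have := le_extWeight ρ q
  gcongr

lemma integrable_exp_extWeight [MeasurableSpace S] {μ : Measure S} [SFinite μ]
    (hμ : ∀ c, Integrable (fun q => Real.exp (c * ρ q)) μ) (τ : ℝ≥0) (c : ℝ) :
    Integrable (fun q => Real.exp (c * extWeight ρ q)) (μ.prod (gaussianReal 0 τ)) := by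
  have := (hμ c).mul_prod (integrable_exp_mul_abs_gaussianReal c 0 τ)
  refine this.congr (ae_of_all _ fun q => ?_)
  simp only [extWeight]
  rw [← Real.exp_add, mul_add]

end ExpBounded

/-! ### Adding a conditionally Gaussian coordinate. -/

section FreshGaussian

variable {Ω : ℕ → Type*} [∀ n, MeasurableSpace (Ω n)] {S : Type*} [MeasurableSpace S]

/-- Empirical averages of exponentially bounded functions of `Y` converge in probability to
the `μ`-expectations. -/
def LLN (P : ∀ n, Measure (Ω n)) (Y : ∀ n, Ω n → Fin n → S) (ρ : S → ℝ) (μ : Measure S) : Prop :=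
  ∀ ψ : S → ℝ, Measurable ψ → ExpBounded ρ ψ →
    Tendsto (fun p : Σ n, Ω n => (∑ i, ψ (Y p.1 p.2 i)) / (p.1 : ℝ)) (highProb P)
      (𝓝 (∫ q, ψ q ∂μ))

/-- With high probability no `Y i` lies in a given `μ`-null set. -/
def AvoidsNull (P : ∀ n, Measure (Ω n)) (Y : ∀ n, Ω n → Fin n → S) (μ : Measure S) : Prop :=
  ∀ N : Set S, MeasurableSet N → μ N = 0 → ∀ᶠ p in highProb P, ∀ i, Y p.1 p.2 i ∉ N

lemma AvoidsNull.eventually {P : ∀ n, Measure (Ω n)} {Y : ∀ n, Ω n → Fin n → S} {μ : Measure S}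
    (h : AvoidsNull P Y μ) {p : S → Prop} (hp : ∀ᵐ q ∂μ, p q) :
    ∀ᶠ x in highProb P, ∀ i, p (Y x.1 x.2 i) := by
  filter_upwards [h (toMeasurable μ {q | ¬ p q}) (measurableSet_toMeasurable _ _)
    (by rw [measure_toMeasurable]; exact hp)] with x hx i
  by_contra hn
  exact hx i (subset_toMeasurable _ _ hn)

/-- Given `Y`, the coordinates of `t` are independent Gaussians with means `m i` and common
variance `v`. -/
def IsGaussianGiven (P : ∀ n, Measure (Ω n)) (Y : ∀ n, Ω n → Fin n → S) (t : ∀ n, Ω n → Fin n → ℝ)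
    (m : ∀ n, Ω n → Fin n → ℝ) (v : ∀ n, Ω n → ℝ≥0) : Prop :=
  ∀ n, ∀ B : Set ((Fin n → S) × (Fin n → ℝ)), MeasurableSet B →
    P n {ω | (Y n ω, t n ω) ∈ B} =
      ∫⁻ ω, (Measure.pi fun i => gaussianReal (m n ω i) (v n ω)) {s | (Y n ω, s) ∈ B} ∂(P n)

variable {P : ∀ n, Measure (Ω n)} [∀ n, IsProbabilityMeasure (P n)]
  {Y : ∀ n, Ω n → Fin n → S} {t m : ∀ n, Ω n → Fin n → ℝ} {v : ∀ n, Ω n → ℝ≥0}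

/-- If the conditional probability of an event tends to zero in probability, its mean, the
unconditional probability, tends to zero by bounded convergence. -/
lemma IsGaussianGiven.eventually_notMem (h : IsGaussianGiven P Y t m v)
    {B : ∀ n, Set ((Fin n → S) × (Fin n → ℝ))} (hB : ∀ n, MeasurableSet (B n))
    (hlim : Tendsto (fun p : Σ n, Ω n => (Measure.pi fun i => gaussianReal (m p.1 p.2 i)
      (v p.1 p.2)) {s | (Y p.1 p.2, s) ∈ B p.1}) (highProb P) (𝓝 0)) :
    ∀ᶠ p in highProb P, (Y p.1 p.2, t p.1 p.2) ∉ B p.1 := by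
  rw [eventually_highProb]
  simp only [not_not]
  have h1 := tendsto_lintegral_of_highProb (P := P)
    (X := fun n ω => (Measure.pi fun i => gaussianReal (m n ω i) (v n ω)) {s | (Y n ω, s) ∈ B n})
    (fun _ _ => prob_le_one) hlim
  exact h1.congr fun n => (h n _ (hB n)).symm

variable {ρ : S → ℝ} {μ : Measure S} [IsProbabilityMeasure μ] {τ : ℝ≥0} {η : (Σ n, Ω n) → ℝ}

/-- Each conditional law may be replaced by `N(0, τ)` at an error controlled by exponentials of `ρ`,
whose empirical averages converge. What remains is an average of the function `Ψ` of the old states,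
to which the old law of large numbers applies. -/
lemma tendsto_average_integral_gaussianReal (hρm : Measurable ρ) (hρ : ∀ q, 0 ≤ ρ q)
    (hμ : ∀ c, Integrable (fun q => Real.exp (c * ρ q)) μ) (hτ : 0 < τ) (hL : LLN P Y ρ μ)
    (hη : Tendsto η (highProb P) (𝓝 0)) (hη0 : ∀ p, 0 ≤ η p)
    (hm : ∀ᶠ p in highProb P, ∀ i, |m p.1 p.2 i| ≤ η p * ρ (Y p.1 p.2 i))
    (hv : Tendsto (fun p : Σ n, Ω n => v p.1 p.2) (highProb P) (𝓝 τ))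
    {ψ : S × ℝ → ℝ} (hψm : Measurable ψ) (hψ : ExpBounded (extWeight ρ) ψ) :
    Tendsto (fun p : Σ n, Ω n => (∑ i, ∫ x, ψ (Y p.1 p.2 i, x)
      ∂(gaussianReal (m p.1 p.2 i) (v p.1 p.2))) / (p.1 : ℝ)) (highProb P)
      (𝓝 (∫ q, ψ q ∂(μ.prod (gaussianReal 0 τ)))) := by
  have hint := hψ.integrable (integrable_exp_extWeight hμ τ) hψm
  obtain ⟨C, c, hC, hc, hψb⟩ := hψ
  -- Normalising the slices of `ψ` makes the Gaussian comparison uniform in `q`.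
  have hsec : ∀ q x, |ψ (q, x) / (C * Real.exp (c * ρ q))| ≤ Real.exp (c * |x|) := by
    intro q x
    rw [abs_div, abs_of_pos (by positivity : 0 < C * Real.exp (c * ρ q)),
      div_le_iff₀ (by positivity)]
    refine (hψb (q, x)).trans (le_of_eq ?_)
    simp only [extWeight]
    rw [mul_add, Real.exp_add]; ring
  set Ψ : S → ℝ := fun q => ∫ x, ψ (q, x) ∂(gaussianReal 0 τ) with hΨ
  have hΨm : Measurable Ψ := (hψm.stronglyMeasurable.integral_prod_right'
    (ν := gaussianReal 0 τ)).measurable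
  have hdiv : ∀ q (ν : Measure ℝ), ∫ x, ψ (q, x) / (C * Real.exp (c * ρ q)) ∂ν
      = (∫ x, ψ (q, x) ∂ν) / (C * Real.exp (c * ρ q)) := fun q ν => integral_div _ _
  have hΨb : ExpBounded ρ Ψ := by
    refine ⟨C * (2 * Real.exp (τ * c ^ 2 / 2)), c, by positivity, hc, fun q => ?_⟩
    have h1 := abs_integral_gaussianReal_le hc 0 τ (hsec q)
    rw [hdiv, abs_div, abs_of_pos (by positivity : 0 < C * Real.exp (c * ρ q)),
      div_le_iff₀ (by positivity)] at h1
    refine h1.trans (le_of_eq ?_)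
    rw [abs_zero, mul_zero, Real.exp_zero]; ring
  have h0 := hL Ψ hΨm hΨb
  have hfub : ∫ q, Ψ q ∂μ = ∫ q, ψ q ∂(μ.prod (gaussianReal 0 τ)) := (integral_prod _ hint).symm
  rw [hfub] at h0
  suffices hD : Tendsto (fun p : Σ n, Ω n => (∑ i, ∫ x, ψ (Y p.1 p.2 i, x)
      ∂(gaussianReal (m p.1 p.2 i) (v p.1 p.2))) / (p.1 : ℝ) - (∑ i, Ψ (Y p.1 p.2 i)) / (p.1 : ℝ))
      (highProb P) (𝓝 0) by
    simpa using hD.add h0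
  rw [Metric.tendsto_nhds]
  intro ε hε
  have hE0 := hL (fun q => Real.exp (c * ρ q)) (by fun_prop) (expBounded_exp c hc)
  -- The exponent collects `c` from the normalisation of the slice, `c` from `exp (c * |m|)` with
  -- `|m| ≤ ρ`, and `1` from `ρ ≤ exp ρ`.
  have hE1 := hL (fun q => Real.exp ((2 * c + 1) * ρ q)) (by fun_prop)
    (expBounded_exp _ (by positivity))
  set E0 := ∫ q, Real.exp (c * ρ q) ∂μ with hE0d
  have hE0n : 0 ≤ E0 := integral_nonneg fun q => (Real.exp_pos _).le
  -- Chosen so that the limiting error `C * δ * E0` is at most `ε / 2`; the other error term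
  -- vanishes with `η`.
  set δ := ε / (2 * C * (E0 + 1)) with hδ
  have hδ0 : 0 < δ := by positivity
  obtain ⟨r, hr, K, hK, hclose⟩ := exists_abs_integral_gaussianReal_sub_le hc hτ hδ0
  have hlim := ((hE0.const_mul (C * δ)).add ((hη.mul hE1).const_mul (C * K)))
  have hlt : C * δ * E0 + C * K * (0 * ∫ q, Real.exp ((2 * c + 1) * ρ q) ∂μ) < ε := by
    have : C * δ * E0 = ε / 2 * (E0 / (E0 + 1)) := by rw [hδ]; field_simp
    rw [this]
    have : E0 / (E0 + 1) ≤ 1 := (div_le_one (by positivity)).2 (by linarith)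
    nlinarith
  filter_upwards [hlim.eventually_lt_const hlt, hm, (Metric.tendsto_nhds.1 hv) r hr,
    hη.eventually_le_const (zero_lt_one' ℝ)] with p hp hmp hvp hη1
  rw [Real.dist_eq, sub_zero]
  refine lt_of_le_of_lt ?_ hp
  rw [← sub_div, ← Finset.sum_sub_distrib, abs_div, Nat.abs_cast]
  have hterm : ∀ i, |∫ x, ψ (Y p.1 p.2 i, x) ∂(gaussianReal (m p.1 p.2 i) (v p.1 p.2))
      - Ψ (Y p.1 p.2 i)| ≤ C * δ * Real.exp (c * ρ (Y p.1 p.2 i))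
        + C * K * η p * Real.exp ((2 * c + 1) * ρ (Y p.1 p.2 i)) := by
    intro i
    set q := Y p.1 p.2 i
    have hρq := hρ q
    have h1 := hclose (m p.1 p.2 i) (v p.1 p.2) hvp
      (fun x => ψ (q, x) / (C * Real.exp (c * ρ q))) (by fun_prop) (hsec q)
    rw [hdiv, hdiv, ← sub_div, abs_div, abs_of_pos (by positivity : 0 < C * Real.exp (c * ρ q)),
      div_le_iff₀ (by positivity)] at h1
    refine h1.trans ?_
    have h2 : |m p.1 p.2 i| ≤ ρ q := (hmp i).trans (by nlinarith)
    have h4 : ρ q ≤ Real.exp (ρ q) := by linarith [Real.add_one_le_exp (ρ q)]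
    have hηρ : 0 ≤ η p * ρ q := (abs_nonneg _).trans (hmp i)
    have h3 : |m p.1 p.2 i| * Real.exp (c * |m p.1 p.2 i|)
        ≤ η p * ρ q * Real.exp (c * ρ q) :=
      mul_le_mul (hmp i) (Real.exp_le_exp.2 (by gcongr)) (Real.exp_pos _).le hηρ
    have h5 : η p * ρ q ≤ η p * Real.exp (ρ q) := mul_le_mul_of_nonneg_left h4 (hη0 p)
    calc (δ + K * |m p.1 p.2 i| * Real.exp (c * |m p.1 p.2 i|)) * (C * Real.exp (c * ρ q))
        = C * δ * Real.exp (c * ρ q) + C * K * Real.exp (c * ρ q) *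
          (|m p.1 p.2 i| * Real.exp (c * |m p.1 p.2 i|)) := by ring
      _ ≤ C * δ * Real.exp (c * ρ q) + C * K * Real.exp (c * ρ q) *
          (η p * Real.exp (ρ q) * Real.exp (c * ρ q)) := by
          have := h3.trans (mul_le_mul_of_nonneg_right h5 (Real.exp_pos (c * ρ q)).le)
          gcongr
      _ = _ := by
          have : Real.exp ((2 * c + 1) * ρ q)
              = Real.exp (c * ρ q) * (Real.exp (ρ q) * Real.exp (c * ρ q)) := by
            rw [← Real.exp_add, ← Real.exp_add]; congr 1; ring
          rw [this]; ring
  calc |∑ i, (∫ x, ψ (Y p.1 p.2 i, x) ∂(gaussianReal (m p.1 p.2 i) (v p.1 p.2))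
      - Ψ (Y p.1 p.2 i))| / (p.1 : ℝ)
      ≤ (∑ i, (C * δ * Real.exp (c * ρ (Y p.1 p.2 i))
        + C * K * η p * Real.exp ((2 * c + 1) * ρ (Y p.1 p.2 i)))) / (p.1 : ℝ) := by
        gcongr
        exact (Finset.abs_sum_le_sum_abs _ _).trans (Finset.sum_le_sum fun i _ => hterm i)
    _ = _ := by
        rw [Finset.sum_add_distrib, ← Finset.mul_sum, ← Finset.mul_sum]
        ring

/-- The law of large numbers is inherited when a conditionally Gaussian coordinate is added. -/
lemma LLN.prod_gaussian (hρm : Measurable ρ) (hρ : ∀ q, 0 ≤ ρ q)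
    (hμ : ∀ c, Integrable (fun q => Real.exp (c * ρ q)) μ) (hτ : 0 < τ) (hL : LLN P Y ρ μ)
    (hη : Tendsto η (highProb P) (𝓝 0)) (hη0 : ∀ p, 0 ≤ η p)
    (hm : ∀ᶠ p in highProb P, ∀ i, |m p.1 p.2 i| ≤ η p * ρ (Y p.1 p.2 i))
    (hv : Tendsto (fun p : Σ n, Ω n => v p.1 p.2) (highProb P) (𝓝 τ))
    (ht : IsGaussianGiven P Y t m v) :
    LLN P (fun n ω i => (Y n ω i, t n ω i)) (extWeight ρ) (μ.prod (gaussianReal 0 τ)) := by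
  intro ψ hψm hψ
  have hA := tendsto_average_integral_gaussianReal hρm hρ hμ hτ hL hη hη0 hm hv hψm hψ
  -- Conditional second moments have a convergent average, so the conditional variance of the
  -- empirical average is of order `1 / n`.
  have hA2 := tendsto_average_integral_gaussianReal hρm hρ hμ hτ hL hη hη0 hm hv (hψm.mul hψm)
    (hψ.mul hψ)
  have hψ2 : ∀ (m : ℝ) (v : ℝ≥0) (q : S), MemLp (fun x => ψ (q, x)) 2 (gaussianReal m v) := by
    intro m v q
    refine ExpBounded.memLp_two (ρ := fun x => |x|)
      (fun c => integrable_exp_mul_abs_gaussianReal c m v) (by fun_prop) ?_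
    obtain ⟨C, c, hC, hc, hb⟩ := hψ
    refine ⟨C * Real.exp (c * ρ q), c, by positivity, hc, fun x => (hb (q, x)).trans ?_⟩
    simp only [extWeight]
    rw [mul_add, Real.exp_add, mul_assoc]
  rw [Metric.tendsto_nhds]
  intro ε hε
  set M := ∫ q, ψ q ∂(μ.prod (gaussianReal 0 τ))
  have hB : ∀ n : ℕ, MeasurableSet {z : (Fin n → S) × (Fin n → ℝ) |
      ε ≤ |(∑ i, ψ (z.1 i, z.2 i)) / (n : ℝ) - M|} := fun n =>
    measurableSet_le measurable_const (by fun_prop)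
  have hev := ht.eventually_notMem hB ?_
  · filter_upwards [hev] with p hp
    simp only [not_le] at hp
    exact hp
  · have hn : Tendsto (fun p : Σ n, Ω n => ((p.1 : ℝ) * (ε / 2) ^ 2)) (highProb P) atTop :=
      (tendsto_natCast_atTop_atTop.comp (tendsto_fst_highProb P)).atTop_mul_const (by positivity)
    have hz := ENNReal.tendsto_ofReal (hA2.div_atTop hn)
    rw [ENNReal.ofReal_zero] at hz
    refine tendsto_of_tendsto_of_tendsto_of_le_of_le' tendsto_const_nhds hz
      (Eventually.of_forall fun _ => zero_le) ?_
    filter_upwards [(Metric.tendsto_nhds.1 hA) (ε / 2) (by positivity)] with p hp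
    rw [Real.dist_eq] at hp
    have hC := measure_pi_abs_average_sub_ge_le
      (fun i => gaussianReal (m p.1 p.2 i) (v p.1 p.2)) (fun i x => ψ (Y p.1 p.2 i, x))
      (fun i => hψ2 _ _ _) (ε := ε / 2) (by positivity)
    simp only [← pow_two]
    refine le_trans (measure_mono ?_) hC
    intro s hs
    simp only [Set.mem_ofPred_eq] at hs ⊢
    have := abs_sub_le ((∑ i, ψ (Y p.1 p.2 i, s i)) / (p.1 : ℝ)) ((∑ i, ∫ x, ψ (Y p.1 p.2 i, x)
      ∂(gaussianReal (m p.1 p.2 i) (v p.1 p.2))) / (p.1 : ℝ)) M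
    linarith

/-- Avoidance of null sets is inherited when a conditionally Gaussian coordinate is added. -/
lemma AvoidsNull.prod_gaussian (hτ : 0 < τ) (hN : AvoidsNull P Y μ)
    (hv : Tendsto (fun p : Σ n, Ω n => v p.1 p.2) (highProb P) (𝓝 τ))
    (ht : IsGaussianGiven P Y t m v) :
    AvoidsNull P (fun n ω i => (Y n ω i, t n ω i)) (μ.prod (gaussianReal 0 τ)) := by
  intro N hNm hN0
  have hB : ∀ n : ℕ, MeasurableSet {z : (Fin n → S) × (Fin n → ℝ) | ∃ i, (z.1 i, z.2 i) ∈ N} := by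
    intro n
    simp only [Set.ofPred_exists]
    exact MeasurableSet.iUnion fun i => hNm.preimage (by fun_prop)
  have hev := ht.eventually_notMem hB ?_
  · filter_upwards [hev] with p hp i hi
    exact hp ⟨i, hi⟩
  · have h1 := (Measure.measure_prod_null hNm).1 hN0
    refine tendsto_const_nhds.congr' ?_
    filter_upwards [hN.eventually h1, hv.eventually_const_lt hτ] with p hp hvp
    symm
    rw [Set.ofPred_exists, measure_iUnion_null_iff]
    intro i
    -- Nondegenerate Gaussians are equivalent to Lebesgue measure, so a section null for `N(0, τ)`
    -- is null for the conditional law.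
    have h2 : gaussianReal (m p.1 p.2 i) (v p.1 p.2) (Prod.mk (Y p.1 p.2 i) ⁻¹' N) = 0 := by
      refine (gaussianReal_absolutelyContinuous _ hvp.ne') ?_
      exact (gaussianReal_absolutelyContinuous' 0 hτ.ne') (hp i)
    have h3 := (measurePreserving_eval (fun i => gaussianReal (m p.1 p.2 i) (v p.1 p.2)) i)
    have h4 := h3.measure_preimage (s := Prod.mk (Y p.1 p.2 i) ⁻¹' N)
      (hNm.preimage (by fun_prop)).nullMeasurableSet
    rw [h2] at h4
    exact h4

end FreshGaussian

/-! ### Resampling a Gaussian matrix off the range of a projection. -/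

section Resampling

variable {n : ℕ}

/-- A square matrix as a function of two indices, from its vector of entries. -/
def toMat (w : Fin n × Fin n → ℝ) : Matrix (Fin n) (Fin n) ℝ := fun i j => w (i, j)

/-- `Wᵀ h`, for `W` given by its vector of entries. -/
def tmul (w : Fin n × Fin n → ℝ) (h : Fin n → ℝ) : Fin n → ℝ := (toMat w)ᵀ *ᵥ h

/-- The entries of `Π W + (1 - Π) W'`. -/
def mix (Q : Matrix (Fin n) (Fin n) ℝ) (w w' : Fin n × Fin n → ℝ) : Fin n × Fin n → ℝ :=
  fun p => (Q * toMat w + (1 - Q) * toMat w') p.1 p.2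

lemma toMat_mix (Q : Matrix (Fin n) (Fin n) ℝ) (w w' : Fin n × Fin n → ℝ) :
    toMat (mix Q w w') = Q * toMat w + (1 - Q) * toMat w' := rfl

lemma toMat_injective : Function.Injective (toMat (n := n)) := fun _ _ h =>
  funext fun p => congrFun (congrFun h p.1) p.2

lemma tmul_apply (w : Fin n × Fin n → ℝ) (h : Fin n → ℝ) (j : Fin n) :
    tmul w h j = ∑ i, w (i, j) * h i := rfl

lemma mix_apply (Q : Matrix (Fin n) (Fin n) ℝ) (w w' : Fin n × Fin n → ℝ) (p : Fin n × Fin n) :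
    mix Q w w' p = ∑ k, Q p.1 k * w (k, p.2) +
      ∑ k, ((1 : Matrix (Fin n) (Fin n) ℝ) p.1 k - Q p.1 k) * w' (k, p.2) := rfl

lemma measurable_tmul {X : Type*} [MeasurableSpace X] {w : X → Fin n × Fin n → ℝ}
    {h : X → Fin n → ℝ} (hw : Measurable w) (hh : Measurable h) :
    Measurable fun x => tmul (w x) (h x) := by
  refine measurable_pi_lambda _ fun j => ?_
  simp only [tmul_apply]
  fun_prop

lemma measurable_mix {X : Type*} [MeasurableSpace X] {Q : X → Matrix (Fin n) (Fin n) ℝ}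
    {w w' : X → Fin n × Fin n → ℝ} (hQ : ∀ i k, Measurable fun x => Q x i k) (hw : Measurable w)
    (hw' : Measurable w') : Measurable fun x => mix (Q x) (w x) (w' x) := by
  refine measurable_pi_lambda _ fun p => ?_
  simp only [mix_apply]
  fun_prop

lemma tmul_sum_smul {d : ℕ} (w : Fin n × Fin n → ℝ) (c : Fin d → ℝ) (h : Fin d → Fin n → ℝ)
    (i : Fin n) :
    tmul w (fun k => ∑ j, c j * h j k) i = ∑ j, c j * tmul w (h j) i := by
  simp only [tmul_apply, Finset.mul_sum]
  rw [Finset.sum_comm]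
  exact Finset.sum_congr rfl fun _ _ => Finset.sum_congr rfl fun _ _ => by ring

variable {Q Q' : Matrix (Fin n) (Fin n) ℝ}

lemma tmul_mix (hs : Qᵀ = Q) (w w' : Fin n × Fin n → ℝ) (h : Fin n → ℝ) :
    tmul (mix Q w w') h = tmul w (Q *ᵥ h) + tmul w' ((1 - Q) *ᵥ h) := by
  unfold tmul
  rw [toMat_mix, transpose_add, transpose_mul, transpose_mul, transpose_sub, hs, transpose_one,
    add_mulVec, mulVec_mulVec, mulVec_mulVec]

/-- Resampling does not change products with vectors in the range of `Q`: what has been observed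
stays fixed. -/
lemma tmul_mix_of_mulVec_eq (hs : Qᵀ = Q) (w w' : Fin n × Fin n → ℝ) {h : Fin n → ℝ}
    (hh : Q *ᵥ h = h) : tmul (mix Q w w') h = tmul w h := by
  rw [tmul_mix hs, sub_mulVec, one_mulVec, hh, sub_self]
  simp [tmul]

/-- The hypotheses say that the range of `Q` lies in that of `Q'`. Resampling can then be done in
two steps, which lets a projection be replaced by a larger one. -/
lemma mix_mix (hl : Q' * Q = Q) (hr : Q * Q' = Q) (w w' w'' : Fin n × Fin n → ℝ) :
    mix Q w (mix Q' w' w'') = mix Q' (mix Q w w') w'' := by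
  apply toMat_injective
  simp only [toMat_mix, mul_add, sub_mul, mul_sub, ← Matrix.mul_assoc, hl, hr, one_mul]
  abel

/-- Pythagoras for the Frobenius norm: `|Q t|² + |(1 - Q) t|² = |t|²`. -/
lemma map_mix_isoGaussian (hs : Qᵀ = Q) (hi : Q * Q = Q) (v : ℝ≥0) :
    ((isoGaussian (Fin n × Fin n) v).prod (isoGaussian (Fin n × Fin n) v)).map
      (fun p => mix Q p.1 p.2) = isoGaussian (Fin n × Fin n) v := by
  have hs' : (1 - Q)ᵀ = 1 - Q := by rw [transpose_sub, hs, transpose_one]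
  have hi' : (1 - Q) * (1 - Q) = 1 - Q := by
    rw [sub_mul, mul_sub, mul_sub, hi]; simp
  have htr : ∀ A B : Matrix (Fin n) (Fin n) ℝ, ∑ p : Fin n × Fin n, A p.1 p.2 * B p.1 p.2
      = (Aᵀ * B).trace := by
    intro A B
    rw [Fintype.sum_prod_type, Finset.sum_comm]
    rfl
  refine map_prod_isoGaussian_eq v _ (measurable_mix (fun _ _ => measurable_const) measurable_fst
    measurable_snd) (fun t p => (Q * toMat t) p.1 p.2) (fun t p => ((1 - Q) * toMat t) p.1 p.2)
    (fun w w' t => ?_) (fun t => ?_)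
  · have h1 := htr (toMat t) (Q * toMat w + (1 - Q) * toMat w')
    have h2 := htr (Q * toMat t) (toMat w)
    have h3 := htr ((1 - Q) * toMat t) (toMat w')
    refine h1.trans (Eq.trans ?_ (congrArg₂ (· + ·) h2 h3).symm)
    rw [transpose_mul, transpose_mul, hs, hs', mul_add, trace_add, Matrix.mul_assoc,
      Matrix.mul_assoc]
  · have h1 := htr (toMat t) (toMat t)
    have h2 := htr (Q * toMat t) (Q * toMat t)
    have h3 := htr ((1 - Q) * toMat t) ((1 - Q) * toMat t)
    simp only [pow_two]
    refine (congrArg₂ (· + ·) h2 h3).trans (Eq.trans ?_ h1.symm)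
    have e : ∀ R : Matrix (Fin n) (Fin n) ℝ, Rᵀ = R → R * R = R →
        (R * toMat t)ᵀ * (R * toMat t) = (toMat t)ᵀ * (R * toMat t) := by
      intro R h h'
      rw [transpose_mul, h, Matrix.mul_assoc, ← Matrix.mul_assoc R R, h']
    rw [e Q hs hi, e _ hs' hi', ← trace_add, ← mul_add, ← add_mul]
    simp

lemma lintegral_mix_isoGaussian (hs : Qᵀ = Q) (hi : Q * Q = Q) (v : ℝ≥0)
    {F : (Fin n × Fin n → ℝ) → ℝ≥0∞} (hF : Measurable F) :
    ∫⁻ w, F w ∂(isoGaussian (Fin n × Fin n) v) =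
      ∫⁻ w, ∫⁻ w', F (mix Q w w') ∂(isoGaussian (Fin n × Fin n) v)
        ∂(isoGaussian (Fin n × Fin n) v) := by
  have hm : Measurable fun p : (Fin n × Fin n → ℝ) × (Fin n × Fin n → ℝ) => mix Q p.1 p.2 :=
    measurable_mix (fun _ _ => measurable_const) measurable_fst measurable_snd
  conv_lhs => rw [← map_mix_isoGaussian hs hi v]
  rw [lintegral_map hF hm]
  exact lintegral_prod _ (hF.comp hm).aemeasurable

lemma map_tmul_isoGaussian (v v' : ℝ≥0) (r : Fin n → ℝ) (hv : (v' : ℝ) = v * (r ⬝ᵥ r)) :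
    (isoGaussian (Fin n × Fin n) v).map (fun w => tmul w r) = isoGaussian (Fin n) v' := by
  refine map_isoGaussian_eq v v' _ (measurable_tmul measurable_id measurable_const)
    (fun t p => r p.1 * t p.2) (fun w t => ?_) (fun t => ?_)
  · simp only [tmul_apply, Finset.mul_sum]
    rw [Fintype.sum_prod_type, Finset.sum_comm]
    exact Finset.sum_congr rfl fun _ _ => Finset.sum_congr rfl fun _ _ => by ring
  · rw [hv, Fintype.sum_prod_type, mul_assoc, dotProduct, Finset.sum_mul]
    congr 1
    refine Finset.sum_congr rfl fun i _ => ?_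
    rw [Finset.mul_sum]
    exact Finset.sum_congr rfl fun _ _ => by ring

/-- The projection `Q` extended by the component of `h` orthogonal to its range. -/
noncomputable def extendProj (Q : Matrix (Fin n) (Fin n) ℝ) (h : Fin n → ℝ) :
    Matrix (Fin n) (Fin n) ℝ :=
  Q + (((1 - Q) *ᵥ h) ⬝ᵥ ((1 - Q) *ᵥ h))⁻¹ • vecMulVec ((1 - Q) *ᵥ h) ((1 - Q) *ᵥ h)

lemma extendProj_transpose (hs : Qᵀ = Q) (h : Fin n → ℝ) :
    (extendProj Q h)ᵀ = extendProj Q h := by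
  rw [extendProj, transpose_add, transpose_smul, hs, transpose_vecMulVec]

lemma mulVec_sub_mulVec (hi : Q * Q = Q) (h : Fin n → ℝ) : Q *ᵥ ((1 - Q) *ᵥ h) = 0 := by
  rw [mulVec_mulVec, mul_sub, hi]; simp

lemma extendProj_mulVec (Q : Matrix (Fin n) (Fin n) ℝ) (h v : Fin n → ℝ) :
    extendProj Q h *ᵥ v = Q *ᵥ v + ((((1 - Q) *ᵥ h) ⬝ᵥ ((1 - Q) *ᵥ h))⁻¹ *
      (((1 - Q) *ᵥ h) ⬝ᵥ v)) • ((1 - Q) *ᵥ h) := by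
  rw [extendProj, add_mulVec, smul_mulVec, vecMulVec_mulVec]
  simp [smul_smul]

lemma extendProj_mulVec_of_mulVec_eq (hs : Qᵀ = Q) (h : Fin n → ℝ) {v : Fin n → ℝ}
    (hv : Q *ᵥ v = v) : extendProj Q h *ᵥ v = v := by
  have h1 : ((1 - Q) *ᵥ h) ⬝ᵥ v = 0 := by
    rw [dotProduct_comm, dotProduct_mulVec, ← mulVec_transpose, transpose_sub, hs, transpose_one,
      sub_mulVec, hv]
    simp
  rw [extendProj_mulVec, h1, hv]; simp

lemma extendProj_mulVec_self (hs : Qᵀ = Q) (hi : Q * Q = Q) (h : Fin n → ℝ) :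
    extendProj Q h *ᵥ h = h := by
  set r := (1 - Q) *ᵥ h with hr
  have h0 : h = Q *ᵥ h + r := by rw [hr, sub_mulVec, one_mulVec]; simp
  have h1 : r ⬝ᵥ h = r ⬝ᵥ r := by
    conv_lhs => rw [h0]
    rw [dotProduct_add, dotProduct_mulVec, ← mulVec_transpose, hs, mulVec_sub_mulVec hi]
    simp
  rw [extendProj_mulVec, ← hr, h1]
  -- If `h` is already in the range, the inverse takes the value zero but multiplies a zero matrix,
  -- so no case distinction is needed in the definition.
  by_cases hz : r ⬝ᵥ r = 0
  · have : r = 0 := dotProduct_self_eq_zero.1 hz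
    rw [this] at h0 ⊢
    simpa using h0.symm
  · rw [inv_mul_cancel₀ hz, one_smul]; exact h0.symm

lemma extendProj_mul (hs : Qᵀ = Q) (hi : Q * Q = Q) (h : Fin n → ℝ) : extendProj Q h * Q = Q := by
  rw [extendProj, add_mul, hi, smul_mul, vecMulVec_mul, ← mulVec_transpose, hs,
    mulVec_sub_mulVec hi]
  simp

lemma extendProj_mul_self (hs : Qᵀ = Q) (hi : Q * Q = Q) (h : Fin n → ℝ) :
    extendProj Q h * extendProj Q h = extendProj Q h := by
  have h1 : extendProj Q h *ᵥ ((1 - Q) *ᵥ h) = (1 - Q) *ᵥ h := by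
    rw [sub_mulVec, one_mulVec, mulVec_sub, extendProj_mulVec_self hs hi,
      extendProj_mulVec_of_mulVec_eq hs h (v := Q *ᵥ h)]
    rw [mulVec_mulVec, hi]
  have h2 : extendProj Q h = Q + (((1 - Q) *ᵥ h) ⬝ᵥ ((1 - Q) *ᵥ h))⁻¹ •
      vecMulVec ((1 - Q) *ᵥ h) ((1 - Q) *ᵥ h) := rfl
  calc extendProj Q h * extendProj Q h
      = extendProj Q h * (Q + (((1 - Q) *ᵥ h) ⬝ᵥ ((1 - Q) *ᵥ h))⁻¹ •
        vecMulVec ((1 - Q) *ᵥ h) ((1 - Q) *ᵥ h)) := by rw [← h2]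
    _ = extendProj Q h := by
      rw [mul_add, extendProj_mul hs hi, Matrix.mul_smul, mul_vecMulVec, h1, ← h2]

lemma extendProj_mulVec_eq_zero (hs : Qᵀ = Q) {h v : Fin n → ℝ} (hv : Q *ᵥ v = 0)
    (hh : h ⬝ᵥ v = 0) : extendProj Q h *ᵥ v = 0 := by
  have h1 : ((1 - Q) *ᵥ h) ⬝ᵥ v = 0 := by
    rw [sub_mulVec, sub_dotProduct, one_mulVec, hh, dotProduct_comm, dotProduct_mulVec,
      ← mulVec_transpose, hs, hv]
    simp
  rw [extendProj_mulVec, h1, hv]; simp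

lemma measurable_extendProj {X : Type*} [MeasurableSpace X] {Q : X → Matrix (Fin n) (Fin n) ℝ}
    {h : X → Fin n → ℝ} (hQ : ∀ i k, Measurable fun x => Q x i k) (hh : Measurable h)
    (i k : Fin n) : Measurable fun x => extendProj (Q x) (h x) i k := by
  have hr : ∀ i, Measurable fun x => ((1 - Q x) *ᵥ (h x)) i := by
    intro i
    have e : (fun x => ((1 - Q x) *ᵥ (h x)) i)
        = fun x => ∑ k, ((1 : Matrix (Fin n) (Fin n) ℝ) i k - Q x i k) * h x k := rfl
    rw [e]
    exact Finset.measurable_sum _ fun k _ => ((hQ i k).const_sub _).mul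
      ((measurable_pi_apply k).comp hh)
  have e : (fun x => extendProj (Q x) (h x) i k) = fun x => Q x i k +
      (∑ j, ((1 - Q x) *ᵥ (h x)) j * ((1 - Q x) *ᵥ (h x)) j)⁻¹ *
        (((1 - Q x) *ᵥ (h x)) i * ((1 - Q x) *ᵥ (h x)) k) := rfl
  rw [e]
  exact (hQ i k).add (((Finset.measurable_sum _ fun j _ => (hr j).mul (hr j)).inv).mul
    ((hr i).mul (hr k)))

end Resampling

/-! ### Stages: partially observed weights and their infinite-width limit. -/

/-- The weights below the output layer: the columns of `U` and the entries of `W`. -/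
abbrev HiddenWeights (nin n : ℕ) : Type := (Fin n → Fin nin → ℝ) × (Fin n × Fin n → ℝ)

/-- The law of the weights below the output layer. -/
noncomputable def hiddenLaw (nin : ℕ) (vu vw : ℝ≥0) (n : ℕ) : Measure (HiddenWeights nin n) :=
  (Measure.pi fun _ => isoGaussian (Fin nin) vu).prod (isoGaussian (Fin n × Fin n) (vw / n))

instance (nin : ℕ) (vu vw : ℝ≥0) (n : ℕ) : IsProbabilityMeasure (hiddenLaw nin vu vw n) := by
  unfold hiddenLaw; infer_instance

/-- A finite family of vectors `f j (Y)`, whose entries are functions of the state `Y i` of neuron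
`i`, together with the vectors `γ j (Y) = Wᵀ f j (Y)`, such that the states behave like i.i.d.
samples of `μ` in the infinite-width limit. -/
structure Stage (nin : ℕ) (vu vw : ℝ≥0) where
  S : Type
  mS : MeasurableSpace S
  ρ : S → ℝ
  ρ_meas : Measurable ρ
  ρ_nonneg : ∀ q, 0 ≤ ρ q
  μ : Measure S
  prob : IsProbabilityMeasure μ
  exp_integrable : ∀ c, Integrable (fun q => Real.exp (c * ρ q)) μ
  u : S → Fin nin → ℝ
  u_meas : Measurable u
  u_le : ∀ q r, |u q r| ≤ ρ q
  d : ℕ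
  γ : Fin d → S → ℝ
  γ_meas : ∀ j, Measurable (γ j)
  γ_le : ∀ j q, |γ j q| ≤ ρ q
  f : Fin d → S → ℝ
  f_meas : ∀ j, Measurable (f j)
  f_bdd : ∀ j, ExpBounded ρ (f j)
  orthonormal : ∀ i j, ∫ q, f i q * f j q ∂μ = if i = j then 1 else 0
  -- Under `μ` the coordinates of `u` and the `γ j` are independent centered Gaussians of variances
  -- `vu` and `vw`.
  charFun : ∀ (t : Fin nin → ℝ) (c : Fin d → ℝ),
    ∫ q, Complex.exp (((∑ r, t r * u q r + ∑ j, c j * γ j q : ℝ) : ℂ) * Complex.I) ∂μ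
      = Complex.exp (-((vu * ∑ r, t r ^ 2 + vw * ∑ j, c j ^ 2 : ℝ) : ℂ) / 2)
  Y : ∀ n, HiddenWeights nin n → Fin n → S
  Y_meas : ∀ n, Measurable (Y n)
  u_Y : ∀ n ω i, u (Y n ω i) = ω.1 i
  tmul_f_Y : ∀ n (ω : HiddenWeights nin n) j i,
    tmul ω.2 (fun k => f j (Y n ω k)) i = γ j (Y n ω i)
  lln : LLN (hiddenLaw nin vu vw) Y ρ μ
  -- Needed because membership in the span of the `f j` is only known almost everywhere, while the
  -- network evaluates functions at every neuron.
  avoidsNull : AvoidsNull (hiddenLaw nin vu vw) Y μ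
  proj : ∀ n, (Fin n → S) → Matrix (Fin n) (Fin n) ℝ
  proj_meas : ∀ n i k, Measurable fun y => proj n y i k
  proj_transpose : ∀ n y, (proj n y)ᵀ = proj n y
  proj_mul_self : ∀ n y, proj n y * proj n y = proj n y
  -- With symmetry and idempotence, this and the next field characterise the orthogonal projection
  -- onto the span of the vectors `f j (y)`.
  proj_f : ∀ n y j, proj n y *ᵥ (fun i => f j (y i)) = fun i => f j (y i)
  proj_eq_zero : ∀ n y (x : Fin n → ℝ), (∀ j, (fun i => f j (y i)) ⬝ᵥ x = 0) → proj n y *ᵥ x = 0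
  -- The conditional law of `W` given the states, phrased without conditional expectations: the part
  -- of `W` off the range of `proj` may be replaced by an independent copy.
  resample : ∀ n (F : (Fin n → S) × (Fin n × Fin n → ℝ) → ℝ≥0∞), Measurable F →
    ∫⁻ ω, F (Y n ω, ω.2) ∂(hiddenLaw nin vu vw n) =
      ∫⁻ ω, ∫⁻ w', F (Y n ω, mix (proj n (Y n ω)) ω.2 w')
        ∂(isoGaussian (Fin n × Fin n) (vw / n)) ∂(hiddenLaw nin vu vw n)

attribute [instance] Stage.mS Stage.prob

namespace Stage

variable {nin : ℕ} {vu vw : ℝ≥0} (T : Stage nin vu vw) {f₀ : T.S → ℝ}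

/-- A larger projection frees less of `W`, so its resampling property is weaker. Resample with the
stage's own projection on both sides, split the fresh matrix along `Q`, and recombine by `mix_mix`.
-/
lemma resample_of_proj_mul (n : ℕ) (Q : (Fin n → T.S) → Matrix (Fin n) (Fin n) ℝ)
    (hQm : ∀ i k, Measurable fun y => Q y i k) (hs : ∀ y, (Q y)ᵀ = Q y)
    (hi : ∀ y, Q y * Q y = Q y) (hQ : ∀ y, Q y * T.proj n y = T.proj n y)
    (F : (Fin n → T.S) × (Fin n × Fin n → ℝ) → ℝ≥0∞) (hF : Measurable F) :
    ∫⁻ ω, F (T.Y n ω, ω.2) ∂(hiddenLaw nin vu vw n) =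
      ∫⁻ ω, ∫⁻ w', F (T.Y n ω, mix (Q (T.Y n ω)) ω.2 w')
        ∂(isoGaussian (Fin n × Fin n) (vw / n)) ∂(hiddenLaw nin vu vw n) := by
  have hQ' : ∀ y, T.proj n y * Q y = T.proj n y := by
    intro y
    rw [← T.proj_transpose, ← hs, ← transpose_mul, hQ]
  have hG : Measurable fun z : (Fin n → T.S) × (Fin n × Fin n → ℝ) =>
      ∫⁻ w'', F (z.1, mix (Q z.1) z.2 w'') ∂(isoGaussian (Fin n × Fin n) (vw / n)) := by
    apply Measurable.lintegral_prod_right'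
      (f := fun x : ((Fin n → T.S) × (Fin n × Fin n → ℝ)) × (Fin n × Fin n → ℝ) =>
        F (x.1.1, mix (Q x.1.1) x.1.2 x.2))
    exact hF.comp (Measurable.prodMk (by fun_prop) (measurable_mix
      (fun i k => (hQm i k).comp (by fun_prop)) (by fun_prop) (by fun_prop)))
  rw [T.resample n F hF, T.resample n _ hG]
  refine lintegral_congr fun ω => ?_
  have hF' : Measurable fun w' => F (T.Y n ω, mix (T.proj n (T.Y n ω)) ω.2 w') :=
    hF.comp (Measurable.prodMk measurable_const
      (measurable_mix (fun _ _ => measurable_const) measurable_const measurable_id))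
  rw [lintegral_mix_isoGaussian (hs (T.Y n ω)) (hi _) _ hF']
  simp_rw [mix_mix (hQ _) (hQ' _)]

/-- The vector with entries `f₀ (Y i)`. -/
def vec (f₀ : T.S → ℝ) (n : ℕ) (y : Fin n → T.S) : Fin n → ℝ := fun i => f₀ (y i)

lemma measurable_vec (hm : Measurable f₀) (n : ℕ) : Measurable (T.vec f₀ n) :=
  measurable_pi_lambda _ fun i => hm.comp (measurable_pi_apply i)

/-- Conditional mean of `Wᵀ f₀ (Y)` given `Y`. -/
noncomputable def condMean (f₀ : T.S → ℝ) (n : ℕ) (ω : HiddenWeights nin n) : Fin n → ℝ :=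
  tmul ω.2 (T.proj n (T.Y n ω) *ᵥ T.vec f₀ n (T.Y n ω))

/-- Component of `f₀ (Y)` orthogonal to the vectors `f j (Y)`. -/
noncomputable def resid (f₀ : T.S → ℝ) (n : ℕ) (y : Fin n → T.S) : Fin n → ℝ :=
  (1 - T.proj n y) *ᵥ T.vec f₀ n y

/-- Conditional variance of the entries of `Wᵀ f₀ (Y)` given `Y`. -/
noncomputable def condVar (f₀ : T.S → ℝ) (n : ℕ) (ω : HiddenWeights nin n) : ℝ≥0 :=
  vw / n * (T.resid f₀ n (T.Y n ω) ⬝ᵥ T.resid f₀ n (T.Y n ω)).toNNReal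

/-- After resampling, `Wᵀ f₀(Y)` is the old matrix applied to the projected vector plus a fresh
matrix applied to the residual. The first term is the conditional mean and the second is isotropic
Gaussian. -/
lemma isGaussianGiven (hm : Measurable f₀) :
    IsGaussianGiven (hiddenLaw nin vu vw) T.Y (fun n ω => tmul ω.2 (T.vec f₀ n (T.Y n ω)))
      (T.condMean f₀) (T.condVar f₀) := by
  intro n B hB
  have hΘ : Measurable fun z : (Fin n → T.S) × (Fin n × Fin n → ℝ) =>
      (z.1, tmul z.2 (T.vec f₀ n z.1)) :=
    measurable_fst.prodMk (measurable_tmul measurable_snd ((T.measurable_vec hm n).comp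
      measurable_fst))
  have hΩ : Measurable fun ω : HiddenWeights nin n => (T.Y n ω, ω.2) :=
    (T.Y_meas n).prodMk measurable_snd
  have h1 := T.resample n (fun z => Set.indicator B 1 (z.1, tmul z.2 (T.vec f₀ n z.1)))
    ((measurable_one.indicator hB).comp hΘ)
  have h2 : ∀ ω : HiddenWeights nin n, Set.indicator B (1 : (Fin n → T.S) × (Fin n → ℝ) → ℝ≥0∞)
      (T.Y n ω, tmul ω.2 (T.vec f₀ n (T.Y n ω))) =
      Set.indicator {ω : HiddenWeights nin n | (T.Y n ω, tmul ω.2 (T.vec f₀ n (T.Y n ω))) ∈ B}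
        1 ω := fun ω => rfl
  simp only [h2] at h1
  have hBΩ : MeasurableSet {ω : HiddenWeights nin n |
      (T.Y n ω, tmul ω.2 (T.vec f₀ n (T.Y n ω))) ∈ B} := hB.preimage (hΘ.comp hΩ)
  rw [lintegral_indicator_one hBΩ] at h1
  rw [h1]
  refine lintegral_congr fun ω => ?_
  have hsl : MeasurableSet {s | (T.Y n ω, s) ∈ B} := hB.preimage (by fun_prop)
  have h3 : ∀ w' : Fin n × Fin n → ℝ, Set.indicator B (1 : (Fin n → T.S) × (Fin n → ℝ) → ℝ≥0∞)
      (T.Y n ω, tmul (mix (T.proj n (T.Y n ω)) ω.2 w') (T.vec f₀ n (T.Y n ω))) =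
      Set.indicator {s | (T.Y n ω, s) ∈ B} 1
        (T.condMean f₀ n ω + tmul w' (T.resid f₀ n (T.Y n ω))) := by
    intro w'
    rw [tmul_mix (T.proj_transpose n _)]
    rfl
  simp only [h3]
  have hmt : Measurable fun w' : Fin n × Fin n → ℝ => tmul w' (T.resid f₀ n (T.Y n ω)) :=
    measurable_tmul measurable_id measurable_const
  have hv : ((T.condVar f₀ n ω : ℝ≥0) : ℝ) = ((vw / n : ℝ≥0) : ℝ) *
      (T.resid f₀ n (T.Y n ω) ⬝ᵥ T.resid f₀ n (T.Y n ω)) := by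
    rw [condVar, NNReal.coe_mul, Real.coe_toNNReal]
    exact Finset.sum_nonneg fun i _ => mul_self_nonneg _
  rw [← map_const_add_isoGaussian, ← map_tmul_isoGaussian _ _ _ hv, Measure.map_map
    (by fun_prop) hmt, ← lintegral_indicator_one hsl, lintegral_map
    (measurable_one.indicator hsl) ((measurable_const_add _).comp hmt)]
  rfl

/-- Regression of `f₀ (Y)` on the vectors `f j (Y)`: for `f₀` orthonormal to the `f j` in the
limit, the coefficients vanish and the residual variance is one in the limit. -/
lemma exists_condMean_bound (hm : Measurable f₀) (hb : ExpBounded T.ρ f₀)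
    (h0 : ∀ j, ∫ q, T.f j q * f₀ q ∂T.μ = 0) (h1 : ∫ q, f₀ q * f₀ q ∂T.μ = 1) :
    (∃ η : (Σ n, HiddenWeights nin n) → ℝ, Tendsto η (highProb (hiddenLaw nin vu vw)) (𝓝 0) ∧
      (∀ p, 0 ≤ η p) ∧ ∀ᶠ p in highProb (hiddenLaw nin vu vw), ∀ i,
        |T.condMean f₀ p.1 p.2 i| ≤ η p * T.ρ (T.Y p.1 p.2 i)) ∧
    Tendsto (fun p : Σ n, HiddenWeights nin n => T.condVar f₀ p.1 p.2)
      (highProb (hiddenLaw nin vu vw)) (𝓝 vw) := by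
  set l := highProb (hiddenLaw nin vu vw) with hl
  set A : (Σ n, HiddenWeights nin n) → Matrix (Fin T.d) (Fin T.d) ℝ := fun p j k =>
    (∑ i, T.f j (T.Y p.1 p.2 i) * T.f k (T.Y p.1 p.2 i)) / (p.1 : ℝ) with hA
  set b : (Σ n, HiddenWeights nin n) → Fin T.d → ℝ := fun p j =>
    (∑ i, T.f j (T.Y p.1 p.2 i) * f₀ (T.Y p.1 p.2 i)) / (p.1 : ℝ) with hbd
  have hAlim : Tendsto A l (𝓝 1) := by
    refine tendsto_pi_nhds.2 fun j => tendsto_pi_nhds.2 fun k => ?_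
    have := T.lln (fun q => T.f j q * T.f k q) ((T.f_meas j).mul (T.f_meas k))
      ((T.f_bdd j).mul (T.f_bdd k))
    rw [T.orthonormal] at this
    exact this
  have hblim : Tendsto b l (𝓝 0) := by
    refine tendsto_pi_nhds.2 fun j => ?_
    have := T.lln (fun q => T.f j q * f₀ q) ((T.f_meas j).mul hm) ((T.f_bdd j).mul hb)
    rw [h0] at this
    exact this
  have hc := T.lln (fun q => f₀ q * f₀ q) (hm.mul hm) (hb.mul hb)
  rw [h1] at hc
  have hdet : Tendsto (fun p => (A p).det) l (𝓝 1) := by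
    have := (continuous_id.matrix_det (n := Fin T.d) (R := ℝ)).tendsto 1 |>.comp hAlim
    simpa [Function.comp_def] using this
  have hinv : Tendsto (fun p => (A p)⁻¹) l (𝓝 1) := by
    have h2 := (continuous_id.matrix_adjugate (n := Fin T.d) (R := ℝ)).tendsto 1 |>.comp hAlim
    have h3 := (hdet.inv₀ one_ne_zero).smul h2
    simp only [Matrix.inv_def, Ring.inverse_eq_inv']
    simpa using h3
  set a : (Σ n, HiddenWeights nin n) → Fin T.d → ℝ := fun p => (A p)⁻¹ *ᵥ b p with had
  have halim : Tendsto a l (𝓝 0) := by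
    have h2 : Continuous fun z : Matrix (Fin T.d) (Fin T.d) ℝ × (Fin T.d → ℝ) => z.1 *ᵥ z.2 :=
      continuous_fst.matrix_mulVec continuous_snd
    have h3 := (h2.tendsto (1, 0)).comp (hinv.prodMk_nhds hblim)
    simpa [Function.comp_def] using h3
  -- On this event the empirical regression problem is nonsingular and the averages can be cleared
  -- of their denominator.
  have hgood : ∀ᶠ p in l, (A p).det ≠ 0 ∧ 0 < p.1 :=
    (hdet.eventually_ne one_ne_zero).and
      ((tendsto_fst_highProb (hiddenLaw nin vu vw)).eventually_gt_atTop 0)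
  have hproj : ∀ p, (A p).det ≠ 0 → 0 < p.1 →
      T.proj p.1 (T.Y p.1 p.2) *ᵥ T.vec f₀ p.1 (T.Y p.1 p.2)
        = fun i => ∑ j, a p j * T.f j (T.Y p.1 p.2 i) := by
    intro p hp hn
    have hn' : (p.1 : ℝ) ≠ 0 := by positivity
    set y := T.Y p.1 p.2
    have hF : T.proj p.1 y *ᵥ (fun i => ∑ j, a p j * T.f j (y i))
        = fun i => ∑ j, a p j * T.f j (y i) := by
      have e : (fun i => ∑ j, a p j * T.f j (y i)) = ∑ j, a p j • fun i => T.f j (y i) := by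
        ext i; simp
      rw [e, mulVec_sum]
      simp_rw [mulVec_smul, T.proj_f]
    -- The normal equations `A a = b` say that the regression residual is orthogonal to every `f j
    -- (y)`.
    have hz : T.proj p.1 y *ᵥ (T.vec f₀ p.1 y - fun i => ∑ j, a p j * T.f j (y i)) = 0 := by
      apply T.proj_eq_zero
      intro k
      have h4 : A p *ᵥ a p = b p := by
        rw [had, mulVec_mulVec, mul_nonsing_inv _ (by simpa using hp), one_mulVec]
      have h5 := congrFun h4 k
      simp only [mulVec, dotProduct, hA, hbd] at h5
      simp only [dotProduct, Pi.sub_apply, vec, mul_sub, Finset.sum_sub_distrib]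
      rw [eq_div_iff hn', Finset.sum_mul] at h5
      rw [← h5, sub_eq_zero]
      simp_rw [Finset.mul_sum]
      rw [Finset.sum_comm]
      refine Finset.sum_congr rfl fun j _ => ?_
      rw [mul_right_comm, div_mul_cancel₀ _ hn', Finset.sum_mul]
      exact Finset.sum_congr rfl fun i _ => by ring
    rw [mulVec_sub, hF, sub_eq_zero] at hz
    exact hz
  refine ⟨⟨fun p => ∑ j, |a p j|, ?_, fun p => Finset.sum_nonneg fun _ _ => abs_nonneg _, ?_⟩, ?_⟩
  · have := tendsto_finsetSum (Finset.univ : Finset (Fin T.d))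
      (fun j _ => ((tendsto_pi_nhds.1 halim) j).abs)
    simpa using this
  · filter_upwards [hgood] with p hp i
    rw [condMean, hproj p hp.1 hp.2, tmul_sum_smul, Finset.sum_mul]
    refine (Finset.abs_sum_le_sum_abs _ _).trans (Finset.sum_le_sum fun j _ => ?_)
    rw [abs_mul, T.tmul_f_Y]
    exact mul_le_mul_of_nonneg_left (T.γ_le j _) (abs_nonneg _)
  · have hlim : Tendsto (fun p => vw * (((∑ i, f₀ (T.Y p.1 p.2 i) * f₀ (T.Y p.1 p.2 i)) / (p.1 : ℝ))
        - a p ⬝ᵥ b p).toNNReal) l (𝓝 vw) := by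
      have h2 : Continuous fun z : (Fin T.d → ℝ) × (Fin T.d → ℝ) => z.1 ⬝ᵥ z.2 := by
        simp only [dotProduct]; fun_prop
      have h3 := (h2.tendsto (0, 0)).comp (halim.prodMk_nhds hblim)
      simp only [zero_dotProduct] at h3
      have h4 := ((continuous_real_toNNReal.tendsto _).comp (hc.sub h3)).const_mul vw
      simpa using h4
    refine hlim.congr' ?_
    filter_upwards [hgood] with p hp
    have hn' : (p.1 : ℝ) ≠ 0 := by have := hp.2; positivity
    set y := T.Y p.1 p.2 with hy
    have hr : T.resid f₀ p.1 y ⬝ᵥ T.resid f₀ p.1 y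
        = T.vec f₀ p.1 y ⬝ᵥ T.vec f₀ p.1 y
          - T.vec f₀ p.1 y ⬝ᵥ (T.proj p.1 y *ᵥ T.vec f₀ p.1 y) := by
      -- The complementary projection is symmetric and idempotent, so the squared residual reduces
      -- to the averages of `f₀²` and `a ⬝ᵥ b`.
      have h6 : T.vec f₀ p.1 y ⬝ᵥ (1 - T.proj p.1 y) *ᵥ T.vec f₀ p.1 y
          = T.resid f₀ p.1 y ⬝ᵥ T.resid f₀ p.1 y := by
        have hs : (1 - T.proj p.1 y)ᵀ = 1 - T.proj p.1 y := by
          rw [transpose_sub, T.proj_transpose, transpose_one]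
        have hi : (1 - T.proj p.1 y) * (1 - T.proj p.1 y) = 1 - T.proj p.1 y := by
          rw [sub_mul, mul_sub, mul_sub, T.proj_mul_self]; simp
        conv_rhs => rw [resid, dotProduct_mulVec, ← mulVec_transpose, hs, mulVec_mulVec, hi,
          dotProduct_comm]
      rw [← h6, sub_mulVec, dotProduct_sub, one_mulVec]
    rw [condVar, hr, hproj p hp.1 hp.2]
    rw [div_mul_eq_mul_div, mul_div_assoc]
    congr 1
    have hnn : (p.1 : ℝ≥0) = (p.1 : ℝ).toNNReal := by simp
    rw [hnn, ← Real.toNNReal_div' (by positivity), sub_div]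
    congr 2
    simp only [dotProduct, hbd, vec, Finset.mul_sum, Finset.sum_div]
    rw [Finset.sum_comm]
    exact Finset.sum_congr rfl fun i _ => Finset.sum_congr rfl fun j _ => by ring

end Stage

/-! ### Building stages: the initial one and the adjunction of a vector. -/

namespace Stage

variable {nin : ℕ} {vu vw : ℝ≥0}

/-- The stage without any matrix multiplications by `Wᵀ`. -/
noncomputable def init (nin : ℕ) (vu vw : ℝ≥0) : Stage nin vu vw where
  S := Fin nin → ℝ
  mS := inferInstance
  ρ q := ∑ r, |q r|
  ρ_meas := by fun_prop
  ρ_nonneg q := Finset.sum_nonneg fun _ _ => abs_nonneg _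
  μ := isoGaussian (Fin nin) vu
  prob := inferInstance
  exp_integrable c := by
    have h := Integrable.fintype_prod (μ := fun _ : Fin nin => gaussianReal 0 vu)
      (f := fun (_ : Fin nin) (x : ℝ) => Real.exp (c * |x|))
      (fun _ => integrable_exp_mul_abs_gaussianReal c 0 vu)
    refine h.congr (ae_of_all _ fun q => ?_)
    simp only [Finset.mul_sum, Real.exp_sum]
  u q := q
  u_meas := measurable_id
  u_le q r := Finset.single_le_sum (f := fun r => |q r|) (fun _ _ => abs_nonneg _)
    (Finset.mem_univ r)
  d := 0
  γ j := j.elim0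
  γ_meas j := j.elim0
  γ_le j := j.elim0
  f j := j.elim0
  f_meas j := j.elim0
  f_bdd j := j.elim0
  orthonormal j := j.elim0
  charFun t c := by
    simpa using integral_cexp_sum_isoGaussian vu t
  Y n ω := ω.1
  Y_meas n := measurable_fst
  u_Y n ω i := rfl
  tmul_f_Y n ω j := j.elim0
  lln := by
    intro ψ hψm hψ
    have hμ : ∀ c : ℝ, Integrable (fun q : Fin nin → ℝ => Real.exp (c * ∑ r, |q r|))
        (isoGaussian (Fin nin) vu) := by
      intro c
      have h := Integrable.fintype_prod (μ := fun _ : Fin nin => gaussianReal 0 vu)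
        (f := fun (_ : Fin nin) (x : ℝ) => Real.exp (c * |x|))
        (fun _ => integrable_exp_mul_abs_gaussianReal c 0 vu)
      refine h.congr (ae_of_all _ fun q => ?_)
      simp only [Finset.mul_sum, Real.exp_sum]
    have h2 := hψ.memLp_two hμ hψm
    rw [Metric.tendsto_nhds]
    intro ε hε
    rw [eventually_highProb]
    have hlim : Tendsto (fun n : ℕ => ENNReal.ofReal
        ((∫ q, ψ q ^ 2 ∂(isoGaussian (Fin nin) vu)) / (n * ε ^ 2))) atTop (𝓝 0) := by
      have := ENNReal.tendsto_ofReal (tendsto_const_nhds (x := ∫ q, ψ q ^ 2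
        ∂(isoGaussian (Fin nin) vu)) |>.div_atTop (tendsto_natCast_atTop_atTop.atTop_mul_const
          (by positivity : (0 : ℝ) < ε ^ 2)))
      simpa using this
    refine tendsto_of_tendsto_of_tendsto_of_le_of_le' tendsto_const_nhds hlim
      (Eventually.of_forall fun _ => zero_le) ?_
    filter_upwards [eventually_gt_atTop 0] with n hn
    have hn' : (n : ℝ) ≠ 0 := by positivity
    have hC := measure_pi_abs_average_sub_ge_le (fun _ : Fin n => isoGaussian (Fin nin) vu)
      (fun _ => ψ) (fun _ => h2) hε
    simp only [Finset.sum_const, Finset.card_univ, Fintype.card_fin, nsmul_eq_mul,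
      mul_div_cancel_left₀ _ hn'] at hC
    have hfst : MeasurePreserving (Prod.fst : HiddenWeights nin n → _) (hiddenLaw nin vu vw n)
      (Measure.pi fun _ => isoGaussian (Fin nin) vu) := measurePreserving_fst
    refine le_trans (le_of_eq ?_) hC
    rw [← hfst.measure_preimage (MeasurableSet.nullMeasurableSet
      (measurableSet_le measurable_const (by fun_prop)))]
    congr 1
    ext ω
    simp [Real.dist_eq]
  avoidsNull := by
    intro N hN hN0
    refine eventually_highProb_of_forall_ae fun n => ?_
    change ∀ᵐ ω : HiddenWeights nin n ∂(hiddenLaw nin vu vw n), ∀ i : Fin n, ω.1 i ∉ N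
    rw [ae_all_iff]
    intro i
    have hfst : MeasurePreserving (Prod.fst : HiddenWeights nin n → _) (hiddenLaw nin vu vw n)
      (Measure.pi fun _ => isoGaussian (Fin nin) vu) := measurePreserving_fst
    have h := ((measurePreserving_eval (fun _ : Fin n => isoGaussian (Fin nin) vu) i).comp
      hfst).measure_preimage hN.nullMeasurableSet
    rw [hN0] at h
    rw [ae_iff]
    simp only [not_not]
    exact h
  proj n y := 0
  proj_meas n i k := measurable_const
  proj_transpose n y := transpose_zero
  proj_mul_self n y := zero_mul _
  proj_f n y j := j.elim0
  proj_eq_zero n y x hx := zero_mulVec _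
  -- With zero projection all of `W` is replaced, which is harmless because the states involve only
  -- `U`.
  resample n F hF := by
    have h : ∀ w w' : Fin n × Fin n → ℝ, mix 0 w w' = w' := by
      intro w w'
      apply toMat_injective
      rw [toMat_mix]; simp
    simp only [h]
    unfold hiddenLaw
    rw [lintegral_prod _ (by fun_prop), lintegral_prod _ ?_]
    · simp
    · exact (Measurable.lintegral_prod_right' (f := fun x : HiddenWeights nin n × _ =>
        F (x.1.1, x.2)) (by fun_prop)).aemeasurable

/-- Adjoining the vector `f₀ (Y)` to a stage. -/
noncomputable def extend (T : Stage nin vu vw) (hvw : 0 < vw) (f₀ : T.S → ℝ) (hm : Measurable f₀)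
    (hb : ExpBounded T.ρ f₀) (h0 : ∀ j, ∫ q, T.f j q * f₀ q ∂T.μ = 0)
    (h1 : ∫ q, f₀ q * f₀ q ∂T.μ = 1) : Stage nin vu vw where
  S := T.S × ℝ
  mS := inferInstance
  ρ := extWeight T.ρ
  ρ_meas := by
    have := T.ρ_meas
    unfold extWeight; fun_prop
  ρ_nonneg := extWeight_nonneg T.ρ_nonneg
  μ := T.μ.prod (gaussianReal 0 vw)
  prob := inferInstance
  exp_integrable := integrable_exp_extWeight T.exp_integrable vw
  u q := T.u q.1
  u_meas := T.u_meas.comp measurable_fst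
  u_le q r := (T.u_le q.1 r).trans (le_extWeight _ _)
  d := T.d + 1
  γ := Fin.snoc (α := fun _ => T.S × ℝ → ℝ) (fun j q => T.γ j q.1) (fun q => q.2)
  γ_meas j := by
    refine Fin.lastCases ?_ (fun j => ?_) j
    · rw [Fin.snoc_last]; exact measurable_snd
    · rw [Fin.snoc_castSucc]; exact (T.γ_meas j).comp measurable_fst
  γ_le j := by
    refine Fin.lastCases ?_ (fun j => ?_) j
    · rw [Fin.snoc_last]; exact fun q => le_add_of_nonneg_left (T.ρ_nonneg _)
    · rw [Fin.snoc_castSucc]; exact fun q => (T.γ_le j q.1).trans (le_extWeight _ _)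
  f := Fin.snoc (α := fun _ => T.S × ℝ → ℝ) (fun j q => T.f j q.1) (fun q => f₀ q.1)
  f_meas j := by
    refine Fin.lastCases ?_ (fun j => ?_) j
    · rw [Fin.snoc_last]; exact hm.comp measurable_fst
    · rw [Fin.snoc_castSucc]; exact (T.f_meas j).comp measurable_fst
  f_bdd j := by
    refine Fin.lastCases ?_ (fun j => ?_) j
    · rw [Fin.snoc_last]; exact hb.comp_fst
    · rw [Fin.snoc_castSucc]; exact (T.f_bdd j).comp_fst
  orthonormal i j := by
    have hfst : ∀ g : T.S → ℝ, ∫ q, g q.1 ∂(T.μ.prod (gaussianReal 0 vw)) = ∫ q, g q ∂T.μ := by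
      intro g
      rw [integral_fun_fst]; simp
    refine Fin.lastCases ?_ (fun i => ?_) i <;> refine Fin.lastCases ?_ (fun j => ?_) j
    · simp only [Fin.snoc_last]
      rw [hfst (fun q => f₀ q * f₀ q), h1]; simp
    · simp only [Fin.snoc_last, Fin.snoc_castSucc]
      rw [hfst (fun q => f₀ q * T.f j q)]
      simp_rw [mul_comm (f₀ _)]
      rw [h0, if_neg (Fin.castSucc_lt_last j).ne']
    · simp only [Fin.snoc_last, Fin.snoc_castSucc]
      rw [hfst (fun q => T.f i q * f₀ q), h0, if_neg (Fin.castSucc_lt_last i).ne]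
    · simp only [Fin.snoc_castSucc]
      rw [hfst (fun q => T.f i q * T.f j q), T.orthonormal]
      simp
  charFun t c := by
    have hsplit : ∀ q : T.S × ℝ, Complex.exp (((∑ r, t r * T.u q.1 r + ∑ j, c j *
        Fin.snoc (α := fun _ => T.S × ℝ → ℝ) (fun j q => T.γ j q.1) (fun q => q.2) j q : ℝ) : ℂ)
        * Complex.I) = Complex.exp (((∑ r, t r * T.u q.1 r +
          ∑ j : Fin T.d, c j.castSucc * T.γ j q.1 : ℝ) : ℂ) * Complex.I) *
          Complex.exp ((c (Fin.last T.d) : ℂ) * (q.2 : ℂ) * Complex.I) := by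
      intro q
      rw [← Complex.exp_add, Fin.sum_univ_castSucc]
      simp only [Fin.snoc_castSucc, Fin.snoc_last]
      push_cast
      congr 1
      ring
    simp_rw [hsplit]
    rw [integral_prod_mul (fun q : T.S => Complex.exp (((∑ r, t r * T.u q r +
          ∑ j : Fin T.d, c j.castSucc * T.γ j q : ℝ) : ℂ) * Complex.I))
      (fun x : ℝ => Complex.exp ((c (Fin.last T.d) : ℂ) * (x : ℂ) * Complex.I)), T.charFun,
      ← charFun_apply_real, charFun_gaussianReal, ← Complex.exp_add, Fin.sum_univ_castSucc]
    push_cast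
    congr 1
    ring
  Y n ω i := (T.Y n ω i, tmul ω.2 (T.vec f₀ n (T.Y n ω)) i)
  Y_meas n := measurable_pi_lambda _ fun i =>
    ((measurable_pi_apply i).comp (T.Y_meas n)).prodMk ((measurable_pi_apply i).comp
      (measurable_tmul measurable_snd ((T.measurable_vec hm n).comp (T.Y_meas n))))
  u_Y n ω i := T.u_Y n ω i
  tmul_f_Y n ω j i := by
    refine Fin.lastCases ?_ (fun j => ?_) j
    · simp only [Fin.snoc_last]; rfl
    · simp only [Fin.snoc_castSucc]; exact T.tmul_f_Y n ω j i
  lln := by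
    obtain ⟨⟨η, hη, hη0, hmean⟩, hv⟩ := T.exists_condMean_bound hm hb h0 h1
    exact T.lln.prod_gaussian T.ρ_meas T.ρ_nonneg T.exp_integrable hvw hη hη0 hmean hv
      (T.isGaussianGiven hm)
  avoidsNull := T.avoidsNull.prod_gaussian hvw (T.exists_condMean_bound hm hb h0 h1).2
    (T.isGaussianGiven hm)
  proj n y := extendProj (T.proj n fun i => (y i).1) (T.vec f₀ n fun i => (y i).1)
  proj_meas n i k := measurable_extendProj
    (fun i k => (T.proj_meas n i k).comp (by fun_prop))
    ((T.measurable_vec hm n).comp (by fun_prop)) i k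
  proj_transpose n y := extendProj_transpose (T.proj_transpose n _) _
  proj_mul_self n y := extendProj_mul_self (T.proj_transpose n _) (T.proj_mul_self n _) _
  proj_f n y j := by
    refine Fin.lastCases ?_ (fun j => ?_) j
    · simp only [Fin.snoc_last]
      exact extendProj_mulVec_self (T.proj_transpose n _) (T.proj_mul_self n _) _
    · simp only [Fin.snoc_castSucc]
      exact extendProj_mulVec_of_mulVec_eq (T.proj_transpose n _) _ (T.proj_f n _ j)
  proj_eq_zero n y x hx := by
    refine extendProj_mulVec_eq_zero (T.proj_transpose n _) (T.proj_eq_zero n _ x fun j => ?_) ?_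
    · have := hx j.castSucc
      simpa only [Fin.snoc_castSucc] using this
    · have := hx (Fin.last _)
      simp only [Fin.snoc_last] at this
      exact this
  resample n F hF := by
    have hs := fun y : Fin n → T.S => extendProj_transpose (T.proj_transpose n y) (T.vec f₀ n y)
    have h := T.resample_of_proj_mul n (fun y => extendProj (T.proj n y) (T.vec f₀ n y))
      (measurable_extendProj (T.proj_meas n) (T.measurable_vec hm n)) hs
      (fun y => extendProj_mul_self (T.proj_transpose n _) (T.proj_mul_self n _) _)
      (fun y => extendProj_mul (T.proj_transpose n _) (T.proj_mul_self n _) _)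
      (fun z => F (fun i => (z.1 i, tmul z.2 (T.vec f₀ n z.1) i), z.2))
      (hF.comp ((measurable_pi_lambda _ fun i => ((measurable_pi_apply i).comp
        measurable_fst).prodMk ((measurable_pi_apply i).comp (measurable_tmul measurable_snd
          ((T.measurable_vec hm n).comp measurable_fst)))).prodMk measurable_snd))
    -- The enlarged projection fixes `f₀(Y)`, so the new coordinate of the state is the same before
    -- and after resampling.
    simp only [tmul_mix_of_mulVec_eq (hs _) _ _
      (extendProj_mulVec_self (T.proj_transpose n _) (T.proj_mul_self n _) _)] at h
    exact h

end Stage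

/-! ### Gram–Schmidt: capturing given functions in the span of a stage. -/

namespace Stage

variable {nin : ℕ} {vu vw : ℝ≥0}

/-- `T'` is obtained from `T` by adjoining further vectors. -/
structure Extension (T T' : Stage nin vu vw) where
  π : T'.S → T.S
  measurePreserving : MeasurePreserving π T'.μ T.μ
  π_Y : ∀ n ω i, π (T'.Y n ω i) = T.Y n ω i
  ρ_le : ∀ q, T.ρ (π q) ≤ T'.ρ q
  lift : ∀ c : Fin T.d → ℝ, ∃ c' : Fin T'.d → ℝ, ∀ q,
    ∑ j, c j * T.f j (π q) = ∑ j, c' j * T'.f j q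

/-- The trivial extension. -/
def Extension.refl (T : Stage nin vu vw) : Extension T T where
  π := id
  measurePreserving := MeasurePreserving.id _
  π_Y _ _ _ := rfl
  ρ_le _ := le_rfl
  lift c := ⟨c, fun _ => rfl⟩

/-- Composition of extensions. -/
def Extension.trans {T T' T'' : Stage nin vu vw} (E : Extension T T') (E' : Extension T' T'') :
    Extension T T'' where
  π := E.π ∘ E'.π
  measurePreserving := E.measurePreserving.comp E'.measurePreserving
  π_Y n ω i := by simp only [Function.comp_apply, E'.π_Y, E.π_Y]
  ρ_le q := (E.ρ_le _).trans (E'.ρ_le q)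
  lift c := by
    obtain ⟨c', hc'⟩ := E.lift c
    obtain ⟨c'', hc''⟩ := E'.lift c'
    exact ⟨c'', fun q => (hc' _).trans (hc'' q)⟩

lemma Extension.expBounded {T T' : Stage nin vu vw} (E : Extension T T') {ψ : T.S → ℝ}
    (hψ : ExpBounded T.ρ ψ) : ExpBounded T'.ρ (ψ ∘ E.π) := by
  obtain ⟨C, c, hC, hc, h⟩ := hψ
  refine ⟨C, c, hC, hc, fun q => (h _).trans ?_⟩
  have := E.ρ_le q
  gcongr

variable (T : Stage nin vu vw)

lemma integrable {ψ : T.S → ℝ} (hm : Measurable ψ) (hb : ExpBounded T.ρ ψ) : Integrable ψ T.μ :=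
  hb.integrable T.exp_integrable hm

/-- Every exponentially bounded function lies, up to a null set, in the span of the family `f` of
some extension. -/
lemma exists_extension_span (hvw : 0 < vw) (ψ : T.S → ℝ) (hm : Measurable ψ)
    (hb : ExpBounded T.ρ ψ) :
    ∃ (T' : Stage nin vu vw) (E : Extension T T') (c : Fin T'.d → ℝ),
      ψ ∘ E.π =ᵐ[T'.μ] fun q => ∑ j, c j * T'.f j q := by
  set a : Fin T.d → ℝ := fun j => ∫ q, T.f j q * ψ q ∂T.μ with ha
  set r : T.S → ℝ := fun q => ψ q - ∑ j, a j * T.f j q with hr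
  have hfm := T.f_meas
  have hrm : Measurable r := by fun_prop
  have hrb : ExpBounded T.ρ r := hb.sub T.ρ_nonneg
    (ExpBounded.sum T.ρ_nonneg _ fun j => (T.f_bdd j).const_mul (a j))
  have horth : ∀ j, ∫ q, T.f j q * r q ∂T.μ = 0 := by
    intro j
    have e : ∀ q, T.f j q * r q = T.f j q * ψ q - ∑ k, a k * (T.f j q * T.f k q) := by
      intro q
      rw [hr]
      simp only [mul_sub, Finset.mul_sum]
      congr 1
      exact Finset.sum_congr rfl fun k _ => by ring
    simp_rw [e]
    have hi : ∀ k, Integrable (fun q => a k * (T.f j q * T.f k q)) T.μ := fun k =>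
      (T.integrable (by fun_prop) ((T.f_bdd j).mul (T.f_bdd k))).const_mul _
    rw [integral_sub (T.integrable (by fun_prop) ((T.f_bdd j).mul hb))
      (integrable_finsetSum _ fun k _ => hi k), integral_finsetSum _ fun k _ => hi k]
    simp_rw [integral_const_mul, T.orthonormal]
    simp [ha]
  have hs0 : 0 ≤ ∫ q, r q * r q ∂T.μ := integral_nonneg fun q => mul_self_nonneg _
  -- A zero residual cannot be normalised; then `ψ` is already in the span, but only almost
  -- everywhere. Otherwise the normalised residual is adjoined.
  rcases hs0.eq_or_lt with hs | hs
  · refine ⟨T, Extension.refl T, a, ?_⟩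
    have h1 := (integral_eq_zero_iff_of_nonneg (fun q => mul_self_nonneg (r q))
      (T.integrable (hrm.mul hrm) (hrb.mul hrb))).1 hs.symm
    filter_upwards [h1] with q hq
    have : r q = 0 := mul_self_eq_zero.1 hq
    exact sub_eq_zero.1 this
  · set s := √(∫ q, r q * r q ∂T.μ) with hsd
    have hspos : 0 < s := Real.sqrt_pos.2 hs
    have hs2 : s * s = ∫ q, r q * r q ∂T.μ := Real.mul_self_sqrt hs0
    refine ⟨T.extend hvw (fun q => s⁻¹ * r q) (by fun_prop) (hrb.const_mul _) (fun j => ?_) ?_,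
      ?_, ?_⟩
    · have e : ∀ q, T.f j q * (s⁻¹ * r q) = s⁻¹ * (T.f j q * r q) := fun q => mul_left_comm _ _ _
      simp_rw [e]
      rw [integral_const_mul, horth, mul_zero]
    · have e : ∀ q, s⁻¹ * r q * (s⁻¹ * r q) = (s⁻¹ * s⁻¹) * (r q * r q) := fun q => by ring
      simp_rw [e]
      rw [integral_const_mul, ← hs2]
      field_simp
    · exact
        { π := Prod.fst
          measurePreserving := measurePreserving_fst
          π_Y := fun _ _ _ => rfl
          ρ_le := fun q => le_extWeight _ q
          lift := fun c => by
            refine ⟨Fin.snoc (α := fun _ => ℝ) c 0, fun q => ?_⟩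
            change _ = ∑ j : Fin (T.d + 1), _
            rw [Fin.sum_univ_castSucc]
            simp [extend] }
    · refine ⟨Fin.snoc (α := fun _ => ℝ) a s, ae_of_all _ fun q => ?_⟩
      change _ = ∑ j : Fin (T.d + 1), _
      rw [Fin.sum_univ_castSucc]
      simp only [extend, Fin.snoc_castSucc, Fin.snoc_last]
      rw [mul_inv_cancel_left₀ hspos.ne', hr]
      simp only [add_sub_cancel]
      rfl

/-- Functions are adjoined one at a time. Expansions found earlier survive because `lift` transports
coefficients and projections of states preserve the limit laws. -/
lemma exists_extension_span_finset (hvw : 0 < vw) {ι : Type*} (ψ : ι → T.S → ℝ)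
    (hm : ∀ a, Measurable (ψ a)) (hb : ∀ a, ExpBounded T.ρ (ψ a)) (s : Finset ι) :
    ∃ (T' : Stage nin vu vw) (E : Extension T T'), ∀ a ∈ s, ∃ c : Fin T'.d → ℝ,
      ψ a ∘ E.π =ᵐ[T'.μ] fun q => ∑ j, c j * T'.f j q := by
  classical
  induction s using Finset.induction_on with
  | empty => exact ⟨T, Extension.refl T, by simp⟩
  | insert a s has ih =>
    obtain ⟨T₁, E₁, h₁⟩ := ih
    obtain ⟨T₂, E₂, c, hc⟩ := T₁.exists_extension_span hvw (ψ a ∘ E₁.π)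
      ((hm a).comp E₁.measurePreserving.measurable) (E₁.expBounded (hb a))
    refine ⟨T₂, E₁.trans E₂, fun b hbs => ?_⟩
    rcases Finset.mem_insert.1 hbs with rfl | hbs
    · exact ⟨c, hc⟩
    · obtain ⟨c', hc'⟩ := h₁ b hbs
      obtain ⟨c'', hc''⟩ := E₂.lift c'
      refine ⟨c'', ?_⟩
      filter_upwards [E₂.measurePreserving.quasiMeasurePreserving.ae hc'] with q hq
      rw [← hc'']
      exact hq

/-- If `ψ a` is in the span of the family `f`, then `Wᵀ ψ a (Y)` is the same combination of the
vectors `γ j (Y)`, with high probability. -/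
lemma eventually_tmul_eq {ψ : T.S → ℝ} {c : Fin T.d → ℝ}
    (h : ψ =ᵐ[T.μ] fun q => ∑ j, c j * T.f j q) :
    ∀ᶠ p in highProb (hiddenLaw nin vu vw), ∀ i,
      tmul p.2.2 (T.vec ψ p.1 (T.Y p.1 p.2)) i = ∑ j, c j * T.γ j (T.Y p.1 p.2 i) := by
  filter_upwards [T.avoidsNull.eventually h] with p hp i
  have e : T.vec ψ p.1 (T.Y p.1 p.2) = fun k => ∑ j, c j * T.f j (T.Y p.1 p.2 k) := funext hp
  rw [e, tmul_sum_smul]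
  simp_rw [T.tmul_f_Y]

/-- Parseval's identity; it turns the kernel recursion into inner products of coefficients. -/
lemma integral_mul_of_span {ψ ψ' : T.S → ℝ} {c c' : Fin T.d → ℝ}
    (h : ψ =ᵐ[T.μ] fun q => ∑ j, c j * T.f j q) (h' : ψ' =ᵐ[T.μ] fun q => ∑ j, c' j * T.f j q) :
    ∫ q, ψ q * ψ' q ∂T.μ = ∑ j, c j * c' j := by
  have hfm := T.f_meas
  refine (integral_congr_ae (h.mul h')).trans ?_
  change ∫ q, (∑ j, c j * T.f j q) * (∑ k, c' k * T.f k q) ∂T.μ = _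
  have e : ∀ q, (∑ j, c j * T.f j q) * (∑ k, c' k * T.f k q)
      = ∑ j, ∑ k, c j * c' k * (T.f j q * T.f k q) := by
    intro q
    rw [Finset.sum_mul_sum]
    exact Finset.sum_congr rfl fun j _ => Finset.sum_congr rfl fun k _ => by ring
  simp only [e]
  have hi : ∀ j k, Integrable (fun q => c j * c' k * (T.f j q * T.f k q)) T.μ := fun j k =>
    (T.integrable (by fun_prop) ((T.f_bdd j).mul (T.f_bdd k))).const_mul _
  rw [integral_finsetSum _ fun j _ => integrable_finsetSum _ fun k _ => hi j k]
  refine Finset.sum_congr rfl fun j _ => ?_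
  rw [integral_finsetSum _ fun k _ => hi j k]
  simp_rw [integral_const_mul, T.orthonormal]
  simp

end Stage

/-! ### Gaussian linear forms on a stage. -/

lemma posSemidef_of_gram {κ ι : Type*} [Fintype κ] [Fintype ι] (v : ℝ≥0) (b : κ → ι → ℝ) :
    (Matrix.of fun k l => (v : ℝ) * ∑ j, b k j * b l j).PosSemidef := by
  have h := (posSemidef_self_mul_conjTranspose (Matrix.of b)).smul v.2
  convert h using 1
  ext k l
  simp [mul_apply]

namespace Stage

variable {nin : ℕ} {vu vw : ℝ≥0} (T : Stage nin vu vw)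

/-- Linear combination of the inputs `u` and of the Gaussian fields `γ`. -/
def linForm (a : Fin nin → ℝ) (b : Fin T.d → ℝ) (q : T.S) : ℝ :=
  ∑ r, a r * T.u q r + ∑ j, b j * T.γ j q

lemma measurable_linForm (a : Fin nin → ℝ) (b : Fin T.d → ℝ) : Measurable (T.linForm a b) := by
  have h1 := T.u_meas
  have h2 := T.γ_meas
  unfold linForm
  fun_prop

lemma expBounded_comp_linForm {φ : ℝ → ℝ} (hφ : Controllable φ) (a : Fin nin → ℝ)
    (b : Fin T.d → ℝ) : ExpBounded T.ρ fun q => φ (T.linForm a b q) := by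
  obtain ⟨C, c, hC, hc, h⟩ := hφ
  refine ⟨C, c * (∑ r, |a r| + ∑ j, |b j|), hC, by positivity, fun q => (h _).trans ?_⟩
  have h1 : |T.linForm a b q| ≤ (∑ r, |a r| + ∑ j, |b j|) * T.ρ q := by
    rw [add_mul, Finset.sum_mul, Finset.sum_mul]
    refine (abs_add_le _ _).trans (add_le_add ?_ ?_)
    · refine (Finset.abs_sum_le_sum_abs _ _).trans (Finset.sum_le_sum fun r _ => ?_)
      rw [abs_mul]
      exact mul_le_mul_of_nonneg_left (T.u_le q r) (abs_nonneg _)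
    · refine (Finset.abs_sum_le_sum_abs _ _).trans (Finset.sum_le_sum fun r _ => ?_)
      rw [abs_mul]
      exact mul_le_mul_of_nonneg_left (T.γ_le r q) (abs_nonneg _)
  rw [mul_assoc]
  gcongr

/-- Covariance matrix of a family of linear forms. -/
def linCov {κ : Type*} (a : κ → Fin nin → ℝ) (b : κ → Fin T.d → ℝ) : Matrix κ κ ℝ :=
  fun k l => vu * ∑ r, a k r * a l r + vw * ∑ j, b k j * b l j

lemma posSemidef_linCov {κ : Type*} [Fintype κ] (a : κ → Fin nin → ℝ) (b : κ → Fin T.d → ℝ) :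
    (T.linCov a b).PosSemidef :=
  (posSemidef_of_gram vu a).add (posSemidef_of_gram vw b)

/-- Under the limit law, linear forms in `u` and `γ` are jointly Gaussian. -/
lemma map_linForm {κ : Type*} [Fintype κ] [DecidableEq κ] (a : κ → Fin nin → ℝ)
    (b : κ → Fin T.d → ℝ) :
    T.μ.map (fun q => WithLp.toLp 2 fun k => T.linForm (a k) (b k) q)
      = multivariateGaussian (0 : EuclideanSpace ℝ κ) (T.linCov a b) := by
  have hm : Measurable fun q => (WithLp.toLp 2 fun k => T.linForm (a k) (b k) q :
      EuclideanSpace ℝ κ) :=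
    (WithLp.measurable_toLp 2 _).comp (measurable_pi_lambda _ fun k => T.measurable_linForm _ _)
  have := Measure.isProbabilityMeasure_map (μ := T.μ) hm.aemeasurable
  apply Measure.ext_of_charFun
  ext t
  rw [charFun_multivariateGaussian (T.posSemidef_linCov a b), charFun_apply,
    integral_map hm.aemeasurable (Measurable.aestronglyMeasurable (by fun_prop))]
  have h1 : ∀ q, inner ℝ (WithLp.toLp 2 fun k => T.linForm (a k) (b k) q : EuclideanSpace ℝ κ) t
      = ∑ r, (∑ k, t k * a k r) * T.u q r + ∑ j, (∑ k, t k * b k j) * T.γ j q := by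
    intro q
    simp only [PiLp.inner_apply, linForm]
    simp only [RCLike.inner_apply, conj_trivial, mul_add, Finset.sum_add_distrib, Finset.mul_sum,
      Finset.sum_mul]
    congr 1
    · rw [Finset.sum_comm]
      exact Finset.sum_congr rfl fun _ _ => Finset.sum_congr rfl fun _ _ => by ring
    · rw [Finset.sum_comm]
      exact Finset.sum_congr rfl fun _ _ => Finset.sum_congr rfl fun _ _ => by ring
  simp_rw [h1]
  rw [T.charFun]
  congr 1
  have hsq : ∀ {ι : Type} [Fintype ι] (e : κ → ι → ℝ), ∑ r, (∑ k, t k * e k r) ^ 2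
      = ∑ k, ∑ l, t k * ((∑ r, e k r * e l r) * t l) := by
    intro ι _ e
    simp_rw [pow_two, Finset.sum_mul_sum]
    rw [Finset.sum_comm]
    refine Finset.sum_congr rfl fun k _ => ?_
    rw [Finset.sum_comm]
    refine Finset.sum_congr rfl fun l _ => ?_
    rw [Finset.sum_mul, Finset.mul_sum]
    exact Finset.sum_congr rfl fun _ _ => by ring
  have h2 : (vu * ∑ r, (∑ k, t k * a k r) ^ 2 + vw * ∑ j, (∑ k, t k * b k j) ^ 2 : ℝ)
      = t.ofLp ⬝ᵥ T.linCov a b *ᵥ t.ofLp := by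
    rw [hsq, hsq]
    simp only [dotProduct, mulVec, linCov]
    rw [Finset.mul_sum, Finset.mul_sum, ← Finset.sum_add_distrib]
    refine Finset.sum_congr rfl fun k _ => ?_
    rw [Finset.mul_sum, Finset.mul_sum, Finset.mul_sum, ← Finset.sum_add_distrib]
    exact Finset.sum_congr rfl fun _ _ => by ring
  rw [h2]
  simp
  ring

end Stage

/-! ### The network's layers and kernels, expressed through stages. -/

section Network

variable {nin : ℕ} (φ : ℝ → ℝ) (σu σw : ℝ)

/-- Variance of the entries of `U`. -/
noncomputable def inVar (nin : ℕ) (σu : ℝ) : ℝ≥0 := (σu ^ 2 / nin).toNNReal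

/-- Width-normalized variance of the entries of `W`. -/
noncomputable def recVar (σw : ℝ) : ℝ≥0 := (σw ^ 2).toNNReal

lemma coe_recVar : (recVar σw : ℝ) = σw ^ 2 := Real.coe_toNNReal _ (sq_nonneg _)

lemma inputKernel_eq (x x' : EuclideanSpace ℝ (Fin nin)) :
    inputKernel σu x x' = inVar nin σu * ∑ r, x r * x' r := by
  rw [inputKernel, inVar, Real.coe_toNNReal _ (by positivity), PiLp.inner_apply]
  simp only [RCLike.inner_apply, conj_trivial]
  rw [mul_div_right_comm]
  congr 1
  exact Finset.sum_congr rfl fun _ _ => mul_comm _ _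

/-- The post-activations, as a function of the hidden weights. -/
def hidden {n : ℕ} (ω : HiddenWeights nin n) (x : EuclideanSpace ℝ (Fin nin)) (ℓ : ℕ) :
    Fin n → ℝ :=
  postActivation φ (fun r i => ω.1 i r) (toMat ω.2) x ℓ

lemma transpose_mulVec_apply {n : ℕ} (ω : HiddenWeights nin n) (x : EuclideanSpace ℝ (Fin nin))
    (i : Fin n) : ((fun r i => ω.1 i r : Matrix (Fin nin) (Fin n) ℝ)ᵀ *ᵥ x.ofLp) i
      = ∑ r, x r * ω.1 i r := by
  simp only [mulVec, dotProduct]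
  exact Finset.sum_congr rfl fun r _ => mul_comm _ _

lemma hidden_one {n : ℕ} (ω : HiddenWeights nin n) (x : EuclideanSpace ℝ (Fin nin)) (i : Fin n) :
    hidden φ ω x 1 i = φ (∑ r, x r * ω.1 i r) := by
  simp only [hidden, postActivation]
  congr 1
  exact transpose_mulVec_apply ω x i

lemma hidden_add_two {n : ℕ} (ω : HiddenWeights nin n) (x : EuclideanSpace ℝ (Fin nin)) (ℓ : ℕ)
    (i : Fin n) :
    hidden φ ω x (ℓ + 2) i = φ (tmul ω.2 (hidden φ ω x (ℓ + 1)) i + ∑ r, x r * ω.1 i r) := by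
  simp only [hidden, postActivation]
  congr 2
  exact transpose_mulVec_apply ω x i

variable {φ σu σw}

section Covariances

variable {vw : ℝ≥0} (T : Stage nin (inVar nin σu) vw)

lemma linCov_pair (x x' : EuclideanSpace ℝ (Fin nin)) :
    T.linCov ![x.ofLp, x'.ofLp] ![0, 0] = pairCov (inputKernel σu) x x' := by
  ext k l
  fin_cases k <;> fin_cases l <;> simp [Stage.linCov, pairCov, inputKernel_eq]

/-- The even entries involve only `u` and the odd ones only `γ`; their independence produces the
zeros. -/
lemma linCov_quad {K : EuclideanSpace ℝ (Fin nin) → EuclideanSpace ℝ (Fin nin) → ℝ}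
    (x : Fin 2 → EuclideanSpace ℝ (Fin nin)) (c : Fin 2 → Fin T.d → ℝ)
    (hK : ∀ a b, K (x a) (x b) = vw * ∑ j, c a j * c b j) :
    T.linCov ![(x 0).ofLp, 0, (x 1).ofLp, 0] ![0, c 0, 0, c 1]
      = quadCov (inputKernel σu) K (x 0) (x 1) := by
  ext k l
  fin_cases k <;> fin_cases l <;> simp [Stage.linCov, quadCov, inputKernel_eq, hK]

lemma pairCov_gaussian (hφm : Measurable φ) (hφ : Controllable φ)
    (x x' : EuclideanSpace ℝ (Fin nin)) :
    (pairCov (inputKernel σu) x x').PosSemidef ∧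
    Integrable (fun z : EuclideanSpace ℝ (Fin 2) => φ (z 0) * φ (z 1))
      (multivariateGaussian 0 (pairCov (inputKernel σu) x x')) ∧
    ∫ z, φ (z 0) * φ (z 1) ∂(multivariateGaussian 0 (pairCov (inputKernel σu) x x')) =
      ∫ q, φ (T.linForm x 0 q) * φ (T.linForm x' 0 q) ∂T.μ := by
  have hmap := T.map_linForm ![x.ofLp, x'.ofLp] ![0, 0]
  have hm : Measurable fun q => (WithLp.toLp 2 fun k => T.linForm
      ((![x.ofLp, x'.ofLp] : Fin 2 → Fin nin → ℝ) k) ((![0, 0] : Fin 2 → Fin T.d → ℝ) k) q :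
      EuclideanSpace ℝ (Fin 2)) :=
    (WithLp.measurable_toLp 2 _).comp (measurable_pi_lambda _ fun k => T.measurable_linForm _ _)
  have hg : Measurable fun z : EuclideanSpace ℝ (Fin 2) => φ (z 0) * φ (z 1) := by fun_prop
  rw [← linCov_pair T]
  refine ⟨T.posSemidef_linCov _ _, ?_, ?_⟩
  · rw [← hmap, integrable_map_measure hg.aestronglyMeasurable hm.aemeasurable]
    exact T.integrable (hg.comp hm)
      ((T.expBounded_comp_linForm hφ x 0).mul (T.expBounded_comp_linForm hφ x' 0))
  · rw [← hmap, integral_map hm.aemeasurable hg.aestronglyMeasurable]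
    rfl

lemma linForm_add (a : Fin nin → ℝ) (b : Fin T.d → ℝ) (q : T.S) :
    T.linForm 0 b q + T.linForm a 0 q = T.linForm a b q := by
  simp [Stage.linForm, add_comm]

/-- The Gaussian vector of the recursion is realised by linear forms on the stage, so positivity,
integrability and the value of the integral all transfer from `T.μ`. The hypothesis `hK` is the Gram
representation of the previous kernel. -/
lemma quadCov_gaussian (hφm : Measurable φ) (hφ : Controllable φ)
    {K : EuclideanSpace ℝ (Fin nin) → EuclideanSpace ℝ (Fin nin) → ℝ}
    (x : Fin 2 → EuclideanSpace ℝ (Fin nin)) (c : Fin 2 → Fin T.d → ℝ)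
    (hK : ∀ a b, K (x a) (x b) = vw * ∑ j, c a j * c b j) :
    (quadCov (inputKernel σu) K (x 0) (x 1)).PosSemidef ∧
    Integrable (fun z : EuclideanSpace ℝ (Fin 4) => φ (z 1 + z 0) * φ (z 3 + z 2))
      (multivariateGaussian 0 (quadCov (inputKernel σu) K (x 0) (x 1))) ∧
    ∫ z, φ (z 1 + z 0) * φ (z 3 + z 2)
        ∂(multivariateGaussian 0 (quadCov (inputKernel σu) K (x 0) (x 1))) =
      ∫ q, φ (T.linForm (x 0) (c 0) q) * φ (T.linForm (x 1) (c 1) q) ∂T.μ := by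
  set a : Fin 4 → Fin nin → ℝ := ![(x 0).ofLp, 0, (x 1).ofLp, 0] with ha
  set b : Fin 4 → Fin T.d → ℝ := ![0, c 0, 0, c 1] with hb
  have hmap := T.map_linForm a b
  have hm : Measurable fun q => (WithLp.toLp 2 fun k => T.linForm (a k) (b k) q :
      EuclideanSpace ℝ (Fin 4)) :=
    (WithLp.measurable_toLp 2 _).comp (measurable_pi_lambda _ fun k => T.measurable_linForm _ _)
  have hg : Measurable fun z : EuclideanSpace ℝ (Fin 4) => φ (z 1 + z 0) * φ (z 3 + z 2) := by
    fun_prop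
  have e : ∀ q, φ (T.linForm (a 1) (b 1) q + T.linForm (a 0) (b 0) q) *
      φ (T.linForm (a 3) (b 3) q + T.linForm (a 2) (b 2) q)
      = φ (T.linForm (x 0) (c 0) q) * φ (T.linForm (x 1) (c 1) q) := by
    intro q
    rw [← linForm_add T (x 0) (c 0), ← linForm_add T (x 1) (c 1)]
    rfl
  rw [← linCov_quad T x c hK]
  refine ⟨T.posSemidef_linCov _ _, ?_, ?_⟩
  · rw [← hmap, integrable_map_measure hg.aestronglyMeasurable hm.aemeasurable]
    refine (T.integrable (ψ := fun q => φ (T.linForm (x 0) (c 0) q) * φ (T.linForm (x 1) (c 1) q))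
      ?_ ((T.expBounded_comp_linForm hφ _ _).mul (T.expBounded_comp_linForm hφ _ _))).congr
      (ae_of_all _ fun q => (e q).symm)
    exact (hφm.comp (T.measurable_linForm _ _)).mul (hφm.comp (T.measurable_linForm _ _))
  · rw [← hmap, integral_map hm.aemeasurable hg.aestronglyMeasurable]
    exact integral_congr_ae (ae_of_all _ e)

end Covariances

lemma recVar_pos (hσw : 0 < σw) : 0 < recVar σw := Real.toNNReal_pos.2 (by positivity)

/-- The `ℓ`-th post-activations at the inputs `x a` are functions `ψ a` of the neuron states of
`T`, with high probability. -/
structure Represents (φ : ℝ → ℝ) {m : ℕ} (x : Fin m → EuclideanSpace ℝ (Fin nin)) (ℓ : ℕ)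
    {vu vw : ℝ≥0} (T : Stage nin vu vw) (ψ : Fin m → T.S → ℝ) : Prop where
  meas : ∀ a, Measurable (ψ a)
  bdd : ∀ a, ExpBounded T.ρ (ψ a)
  eventually_eq : ∀ᶠ p in highProb (hiddenLaw nin vu vw), ∀ a i,
    hidden φ p.2 (x a) ℓ i = ψ a (T.Y p.1 p.2 i)

/-- Passing from post-activations to the pre-activations of the next layer. -/
lemma Represents.exists_preactivation (hσw : 0 < σw) {m : ℕ}
    {x : Fin m → EuclideanSpace ℝ (Fin nin)} {ℓ : ℕ} {vu : ℝ≥0} {T : Stage nin vu (recVar σw)}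
    {ψ : Fin m → T.S → ℝ} (h : Represents φ x ℓ T ψ) :
    ∃ (T' : Stage nin vu (recVar σw)) (c : Fin m → Fin T'.d → ℝ),
      (∀ a b, ∫ q, ψ a q * ψ b q ∂T.μ = ∑ j, c a j * c b j) ∧
      ∀ᶠ p in highProb (hiddenLaw nin vu (recVar σw)), ∀ a i,
        tmul p.2.2 (hidden φ p.2 (x a) ℓ) i = ∑ j, c a j * T'.γ j (T'.Y p.1 p.2 i) := by
  obtain ⟨T', E, hE⟩ := T.exists_extension_span_finset (recVar_pos hσw) ψ h.meas h.bdd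
    Finset.univ
  choose c hc using fun a => hE a (Finset.mem_univ a)
  refine ⟨T', c, fun a b => ?_, ?_⟩
  · have hm : Measurable fun q => ψ a q * ψ b q := (h.meas a).mul (h.meas b)
    rw [← T'.integral_mul_of_span (hc a) (hc b), ← E.measurePreserving.map_eq,
      integral_map E.measurePreserving.measurable.aemeasurable hm.aestronglyMeasurable]
    rfl
  · have h1 := eventually_all.2 fun a => T'.eventually_tmul_eq (hc a)
    filter_upwards [h1, h.eventually_eq] with p hp hq a i
    rw [← hp a i]
    congr 1
    ext k
    rw [hq a k, Stage.vec, Function.comp_apply, E.π_Y]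

/-- Passing from pre-activations to post-activations. -/
lemma represents_of_preactivation (hφm : Measurable φ) (hφ : Controllable φ) {m : ℕ}
    {x : Fin m → EuclideanSpace ℝ (Fin nin)} {ℓ : ℕ} {vu vw : ℝ≥0} {T : Stage nin vu vw}
    {c : Fin m → Fin T.d → ℝ}
    (h : ∀ᶠ p in highProb (hiddenLaw nin vu vw), ∀ a i,
        tmul p.2.2 (hidden φ p.2 (x a) (ℓ + 1)) i = ∑ j, c a j * T.γ j (T.Y p.1 p.2 i)) :
    Represents φ x (ℓ + 2) T fun a q => φ (T.linForm (x a) (c a) q) where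
  meas a := hφm.comp (T.measurable_linForm _ _)
  bdd a := T.expBounded_comp_linForm hφ _ _
  eventually_eq := by
    filter_upwards [h] with p hp a i
    rw [hidden_add_two, hp, Stage.linForm, add_comm, T.u_Y]

/-- The induction over layers. The index shift reflects that `h^(ℓ+1)` determines `Σ^(ℓ+2)`:
adjoining the current post-activations yields the next pre-activations as combinations of `γ`, whose
coefficients have the current kernel as Gram matrix. -/
lemma exists_represents (hφm : Measurable φ) (hφ : Controllable φ) (hσw : 0 < σw) {m : ℕ}
    (x : Fin m → EuclideanSpace ℝ (Fin nin)) (ℓ : ℕ) :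
    ∃ (T : Stage nin (inVar nin σu) (recVar σw)) (ψ : Fin m → T.S → ℝ),
      Represents φ x (ℓ + 1) T ψ ∧
      ∀ a b, kernel φ σu σw (ℓ + 2) (x a) (x b) = σw ^ 2 * ∫ q, ψ a q * ψ b q ∂T.μ := by
  induction ℓ with
  | zero =>
    set T := Stage.init nin (inVar nin σu) (recVar σw)
    refine ⟨T, fun a q => φ (T.linForm (x a) 0 q), ⟨fun a => hφm.comp (T.measurable_linForm _ _),
      fun a => T.expBounded_comp_linForm hφ _ _, Eventually.of_forall fun p a i => ?_⟩,
      fun a b => ?_⟩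
    · rw [zero_add, hidden_one, Stage.linForm, T.u_Y]
      simp
    · rw [← (pairCov_gaussian T hφm hφ (x a) (x b)).2.2]
      rfl
  | succ ℓ ih =>
    obtain ⟨T, ψ, hψ, hK⟩ := ih
    obtain ⟨T', c, hc, hpre⟩ := hψ.exists_preactivation hσw
    refine ⟨T', _, represents_of_preactivation hφm hφ hpre, fun a b => ?_⟩
    have h := (quadCov_gaussian T' hφm hφ (K := kernel φ σu σw (ℓ + 2)) ![x a, x b] ![c a, c b]
      (fun k l => by fin_cases k <;> fin_cases l <;> simp [hK, hc, coe_recVar])).2.2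
    exact congrArg (σw ^ 2 * ·) h

/-- The covariance functions are inner products. -/
lemma exists_kernel_eq_gram (hφm : Measurable φ) (hφ : Controllable φ) (hσw : 0 < σw) {m : ℕ}
    (x : Fin m → EuclideanSpace ℝ (Fin nin)) (ℓ : ℕ) :
    ∃ (T : Stage nin (inVar nin σu) (recVar σw)) (c : Fin m → Fin T.d → ℝ),
      ∀ a b, kernel φ σu σw (ℓ + 2) (x a) (x b) = recVar σw * ∑ j, c a j * c b j := by
  obtain ⟨T, ψ, hψ, hK⟩ := exists_represents (σu := σu) hφm hφ hσw x ℓ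
  obtain ⟨T', c, hc, -⟩ := hψ.exists_preactivation hσw
  exact ⟨T', c, fun a b => by rw [hK, hc, coe_recVar]⟩

lemma quadCov_kernel_gaussian (hφm : Measurable φ) (hφ : Controllable φ) (hσw : 0 < σw) (ℓ : ℕ)
    (x x' : EuclideanSpace ℝ (Fin nin)) :
    (quadCov (inputKernel σu) (kernel φ σu σw (ℓ + 2)) x x').PosSemidef ∧
    Integrable (fun z : EuclideanSpace ℝ (Fin 4) => φ (z 1 + z 0) * φ (z 3 + z 2))
      (multivariateGaussian 0
        (quadCov (inputKernel σu) (kernel φ σu σw (ℓ + 2)) x x')) := by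
  obtain ⟨T, c, hc⟩ := exists_kernel_eq_gram (σu := σu) hφm hφ hσw ![x, x'] ℓ
  have h := quadCov_gaussian T hφm hφ ![x, x'] c hc
  exact ⟨h.1, h.2.1⟩

lemma posSemidef_iidCov_kernel (hφm : Measurable φ) (hφ : Controllable φ) (hσw : 0 < σw) (ℓ : ℕ)
    {nout m : ℕ} (s : ℝ) (x : Fin m → EuclideanSpace ℝ (Fin nin)) :
    (iidCov (nout := nout) (fun y y' => s ^ 2 * kernel φ σu σw (ℓ + 2) y y') x).PosSemidef := by
  obtain ⟨T, c, hc⟩ := exists_kernel_eq_gram (σu := σu) hφm hφ hσw x ℓ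
  -- Gram vectors for different output coordinates are placed in orthogonal blocks.
  have h := posSemidef_of_gram (recVar σw) (κ := Fin nout × Fin m) (ι := Fin nout × Fin T.d)
    (fun p j => if p.1 = j.1 then s * c p.2 j.2 else 0)
  convert h using 1
  ext p q
  simp only [iidCov, hc, of_apply, Fintype.sum_prod_type]
  by_cases hpq : p.1 = q.1
  · simp only [hpq, if_true]
    rw [Finset.sum_eq_single q.1 (fun k _ hk => by simp [Ne.symm hk]) (by simp)]
    simp only [if_true, Finset.mul_sum]
    exact Finset.sum_congr rfl fun _ _ => by ring
  · rw [if_neg hpq, Finset.sum_eq_zero, mul_zero]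
    intro k _
    refine Finset.sum_eq_zero fun j _ => ?_
    by_cases hk : p.1 = k
    · have hq : ¬ q.1 = k := fun h' => hpq (hk.trans h'.symm)
      rw [if_neg hq, mul_zero]
    · rw [if_neg hk, zero_mul]

end Network

/-! ### The output layer and its characteristic function. -/

section Output

variable {nin nout n : ℕ}

/-- Index set of all weights of a network of width `n`. -/
abbrev WeightIndex (nin n nout : ℕ) : Type :=
  (Fin nin × Fin n) ⊕ (Fin n × Fin n) ⊕ (Fin n × Fin nout)

/-- The vector of all weights, from the hidden weights and the entries of `V`. -/
def allWeights (z : HiddenWeights nin n × (Fin n × Fin nout → ℝ)) : WeightIndex nin n nout → ℝ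
  | .inl p => z.1.1 p.2 p.1
  | .inr (.inl p) => z.1.2 p
  | .inr (.inr p) => z.2 p

/-- Variances of all weights. -/
noncomputable def weightVar (vu vw vv : ℝ≥0) : WeightIndex nin n nout → ℝ≥0
  | .inl _ => vu
  | .inr (.inl _) => vw / n
  | .inr (.inr _) => vv / n

lemma measurable_allWeights : Measurable (allWeights (nin := nin) (nout := nout) (n := n)) := by
  refine measurable_pi_lambda _ fun s => ?_
  rcases s with p | p | p <;> simp only [allWeights] <;> fun_prop

lemma map_allWeights (vu vw vv : ℝ≥0) :
    ((hiddenLaw nin vu vw n).prod (isoGaussian (Fin n × Fin nout) (vv / n))).map allWeights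
      = Measure.pi fun s => gaussianReal 0 (weightVar (nin := nin) (nout := nout) vu vw vv s) := by
  symm
  apply Measure.pi_eq
  intro s hs
  rw [Measure.map_apply measurable_allWeights (MeasurableSet.univ_pi hs)]
  have e : allWeights ⁻¹' (Set.univ.pi s) =
      ((Set.univ.pi fun i => Set.univ.pi fun r => s (.inl (r, i))) ×ˢ
        (Set.univ.pi fun p => s (.inr (.inl p)))) ×ˢ (Set.univ.pi fun p => s (.inr (.inr p))) := by
    ext z
    simp only [Set.mem_preimage, Set.mem_pi, Set.mem_univ, true_imp_iff, Set.mem_prod, Sum.forall,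
      Prod.forall, allWeights]
    constructor
    · rintro ⟨h1, h2, h3⟩
      exact ⟨⟨fun i r => h1 r i, h2⟩, h3⟩
    · rintro ⟨⟨h1, h2⟩, h3⟩
      exact ⟨fun r i => h1 i r, h2, h3⟩
  rw [e, Measure.prod_prod, hiddenLaw, Measure.prod_prod]
  simp only [isoGaussian, Measure.pi_pi, Fintype.prod_sum_type, Fintype.prod_prod_type, weightVar]
  rw [Finset.prod_comm, mul_assoc]

variable (φ : ℝ → ℝ)

/-- The output vector as a function of the vector of all weights. -/
noncomputable def outputOfWeights {m : ℕ} (L : ℕ) (x : Fin m → EuclideanSpace ℝ (Fin nin))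
    (e : WeightIndex nin n nout → ℝ) : EuclideanSpace ℝ (Fin nout × Fin m) :=
  outputVector φ (fun r i => e (.inl (r, i))) (fun i j => e (.inr (.inl (i, j))))
    (fun i k => e (.inr (.inr (i, k)))) L x

variable {φ}

lemma measurable_postActivation (hφm : Measurable φ) {X : Type*} [MeasurableSpace X]
    {U : X → Matrix (Fin nin) (Fin n) ℝ} {W : X → Matrix (Fin n) (Fin n) ℝ}
    (hU : ∀ i j, Measurable fun e => U e i j) (hW : ∀ i j, Measurable fun e => W e i j)
    (x : EuclideanSpace ℝ (Fin nin)) (ℓ : ℕ) (i : Fin n) :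
    Measurable fun e => postActivation φ (U e) (W e) x ℓ i := by
  have hUx : ∀ i, Measurable fun e => ((U e)ᵀ *ᵥ x.ofLp) i := fun i => by
    simp only [mulVec, dotProduct, transpose_apply]
    exact Finset.measurable_sum _ fun r _ => (hU r i).mul_const _
  induction ℓ generalizing i with
  | zero => exact measurable_const
  | succ ℓ ih =>
    cases ℓ with
    | zero => exact hφm.comp (hUx i)
    | succ ℓ =>
      refine hφm.comp (Measurable.add ?_ (hUx i))
      simp only [mulVec, dotProduct, transpose_apply]
      exact Finset.measurable_sum _ fun k _ => (hW k i).mul (ih k)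

lemma measurable_outputOfWeights (hφm : Measurable φ) {m : ℕ} (L : ℕ)
    (x : Fin m → EuclideanSpace ℝ (Fin nin)) :
    Measurable (outputOfWeights (nin := nin) (nout := nout) (n := n) φ L x) := by
  refine (WithLp.measurable_toLp 2 _).comp (measurable_pi_lambda _ fun p => ?_)
  change Measurable fun e : WeightIndex nin n nout → ℝ => ∑ k, e (.inr (.inr (k, p.1))) *
    postActivation φ (fun r i => e (.inl (r, i))) (fun i j => e (.inr (.inl (i, j))))
      (x p.2) (L - 1) k
  refine Finset.measurable_sum _ fun k _ => Measurable.mul ?_ ?_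
  · exact measurable_pi_apply _
  · exact measurable_postActivation hφm (fun _ _ => measurable_pi_apply _)
      (fun _ _ => measurable_pi_apply _) _ _ _

lemma outputOfWeights_allWeights {m : ℕ} (L : ℕ) (x : Fin m → EuclideanSpace ℝ (Fin nin))
    (z : HiddenWeights nin n × (Fin n × Fin nout → ℝ)) (p : Fin nout × Fin m) :
    outputOfWeights φ L x (allWeights z) p
      = ∑ i, z.2 (i, p.1) * hidden φ z.1 (x p.2) (L - 1) i := rfl

/-- Characteristic function of the output: averaging over the output layer first. -/
lemma integral_charFun_output (hφm : Measurable φ) {m : ℕ} (L : ℕ)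
    (x : Fin m → EuclideanSpace ℝ (Fin nin)) (vu vw vv : ℝ≥0)
    (t : EuclideanSpace ℝ (Fin nout × Fin m)) :
    MeasureTheory.charFun ((Measure.pi fun s =>
      gaussianReal 0 (weightVar (n := n) vu vw vv s)).map (outputOfWeights φ L x)) t
      = ∫ ω, Complex.exp (-((vv * ∑ k, ∑ a, ∑ b, t (k, a) * t (k, b) *
          ((∑ i, hidden φ ω (x a) (L - 1) i * hidden φ ω (x b) (L - 1) i) / n) : ℝ) : ℂ) / 2)
          ∂(hiddenLaw nin vu vw n) := by
  have hG := measurable_outputOfWeights (n := n) (nout := nout) hφm L x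
  rw [← map_allWeights, Measure.map_map hG measurable_allWeights, charFun_apply, integral_map
    (hG.comp measurable_allWeights).aemeasurable (Measurable.aestronglyMeasurable (by fun_prop)),
    integral_prod]
  · refine integral_congr_ae (ae_of_all _ fun ω => ?_)
    have h1 : ∀ V : Fin n × Fin nout → ℝ,
        inner ℝ (outputOfWeights φ L x (allWeights (ω, V))) t
          = ∑ s, (∑ a, t (s.2, a) * hidden φ ω (x a) (L - 1) s.1) * V s := by
      intro V
      simp only [PiLp.inner_apply, outputOfWeights_allWeights, RCLike.inner_apply, conj_trivial]
      rw [Fintype.sum_prod_type, Fintype.sum_prod_type,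
        Finset.sum_comm (s := Finset.univ (α := Fin n))]
      refine Finset.sum_congr rfl fun k _ => ?_
      simp only [Finset.mul_sum, Finset.sum_mul]
      rw [Finset.sum_comm]
      exact Finset.sum_congr rfl fun _ _ => Finset.sum_congr rfl fun _ _ => by ring
    simp only [Function.comp_apply, h1]
    rw [integral_cexp_sum_isoGaussian]
    congr 4
    rw [NNReal.coe_div, NNReal.coe_natCast, div_mul_eq_mul_div, mul_div_assoc]
    congr 1
    rw [Fintype.sum_prod_type, Finset.sum_comm, Finset.sum_div]
    refine Finset.sum_congr rfl fun k _ => ?_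
    simp_rw [pow_two, Finset.sum_mul_sum]
    rw [Finset.sum_comm, Finset.sum_div]
    refine Finset.sum_congr rfl fun a _ => ?_
    rw [Finset.sum_comm, Finset.sum_div]
    refine Finset.sum_congr rfl fun b _ => ?_
    rw [← mul_div_assoc, Finset.mul_sum]
    congr 1
    exact Finset.sum_congr rfl fun i _ => by ring
  · refine (integrable_const (1 : ℝ)).mono' (Measurable.aestronglyMeasurable ?_)
      (ae_of_all _ fun z => ?_)
    · have := hG.comp measurable_allWeights
      fun_prop
    · rw [Complex.norm_exp_ofReal_mul_I]

variable {σu σw : ℝ}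

/-- Given the hidden weights the output is Gaussian, and its covariance is an empirical average of
products of post-activations. This average converges in probability by the stage's law of large
numbers. -/
lemma tendsto_charFun_output (hφm : Measurable φ) (hφ : Controllable φ) (hσw : 0 < σw) {m : ℕ}
    (ℓ : ℕ) (x : Fin m → EuclideanSpace ℝ (Fin nin)) (σv : ℝ)
    (t : EuclideanSpace ℝ (Fin nout × Fin m)) :
    Tendsto (fun n : ℕ => MeasureTheory.charFun ((Measure.pi fun s =>
      gaussianReal 0 (weightVar (n := n) (inVar nin σu) (recVar σw) (recVar σv) s)).map
        (outputOfWeights φ (ℓ + 2) x)) t) atTop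
      (𝓝 (MeasureTheory.charFun (multivariateGaussian 0 (iidCov (nout := nout)
        (fun y y' => (σv / σw) ^ 2 * kernel φ σu σw (ℓ + 2) y y') x)) t)) := by
  obtain ⟨T, ψ, hψ, hK⟩ := exists_represents (σu := σu) hφm hφ hσw x ℓ
  rw [charFun_multivariateGaussian (posSemidef_iidCov_kernel hφm hφ hσw ℓ _ x)]
  simp_rw [integral_charFun_output hφm]
  have hlim : ∀ a b, Tendsto (fun p : Σ n, HiddenWeights nin n =>
      (∑ i, hidden φ p.2 (x a) (ℓ + 1) i * hidden φ p.2 (x b) (ℓ + 1) i) / (p.1 : ℝ))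
      (highProb (hiddenLaw nin (inVar nin σu) (recVar σw))) (𝓝 (∫ q, ψ a q * ψ b q ∂T.μ)) := by
    intro a b
    refine (T.lln (fun q => ψ a q * ψ b q) ((hψ.meas a).mul (hψ.meas b))
      ((hψ.bdd a).mul (hψ.bdd b))).congr' ?_
    filter_upwards [hψ.eventually_eq] with p hp
    simp only [hp]
  have hexp : Tendsto (fun p : Σ n, HiddenWeights nin n => Complex.exp (-((recVar σv * ∑ k, ∑ a,
      ∑ b, t (k, a) * t (k, b) * ((∑ i, hidden φ p.2 (x a) (ℓ + 2 - 1) i *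
        hidden φ p.2 (x b) (ℓ + 2 - 1) i) / p.1) : ℝ) : ℂ) / 2))
      (highProb (hiddenLaw nin (inVar nin σu) (recVar σw)))
      (𝓝 (Complex.exp (-((recVar σv * ∑ k, ∑ a, ∑ b, t (k, a) * t (k, b) *
        ∫ q, ψ a q * ψ b q ∂T.μ : ℝ) : ℂ) / 2))) := by
    have h1 : Tendsto (fun p : Σ n, HiddenWeights nin n => (recVar σv : ℝ) * ∑ k, ∑ a, ∑ b,
        t (k, a) * t (k, b) * ((∑ i, hidden φ p.2 (x a) (ℓ + 1) i *
          hidden φ p.2 (x b) (ℓ + 1) i) / (p.1 : ℝ)))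
        (highProb (hiddenLaw nin (inVar nin σu) (recVar σw)))
        (𝓝 (recVar σv * ∑ k, ∑ a, ∑ b, t (k, a) * t (k, b) * ∫ q, ψ a q * ψ b q ∂T.μ)) := by
      refine Tendsto.const_mul _ ?_
      refine tendsto_finsetSum _ fun k _ => ?_
      refine tendsto_finsetSum _ fun a _ => ?_
      refine tendsto_finsetSum _ fun b _ => ?_
      exact (hlim a b).const_mul _
    have hcont : Continuous fun s : ℝ => Complex.exp (-(s : ℂ) / 2) := by fun_prop
    exact (hcont.tendsto _).comp h1
  -- Being an average of squares, the quadratic form is nonnegative, so the exponential is bounded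
  -- by one.
  have hnn : ∀ (n : ℕ) (ω : HiddenWeights nin n), 0 ≤ (recVar σv * ∑ k, ∑ a,
      ∑ b, t (k, a) * t (k, b) * ((∑ i, hidden φ ω (x a) (ℓ + 2 - 1) i *
        hidden φ ω (x b) (ℓ + 2 - 1) i) / n) : ℝ) := by
    intro n ω
    refine mul_nonneg (NNReal.coe_nonneg _) (Finset.sum_nonneg fun k _ => ?_)
    have e : ∑ a, ∑ b, t (k, a) * t (k, b) * ((∑ i, hidden φ ω (x a) (ℓ + 2 - 1) i *
        hidden φ ω (x b) (ℓ + 2 - 1) i) / n)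
        = (∑ i, (∑ a, t (k, a) * hidden φ ω (x a) (ℓ + 2 - 1) i) ^ 2) / (n : ℝ) := by
      symm
      simp_rw [pow_two, Finset.sum_mul_sum]
      rw [Finset.sum_comm, Finset.sum_div]
      refine Finset.sum_congr rfl fun a _ => ?_
      rw [Finset.sum_comm, Finset.sum_div]
      refine Finset.sum_congr rfl fun b _ => ?_
      rw [← mul_div_assoc, Finset.mul_sum]
      congr 1
      exact Finset.sum_congr rfl fun i _ => by ring
    rw [e]
    exact div_nonneg (Finset.sum_nonneg fun _ _ => sq_nonneg _) (Nat.cast_nonneg _)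
  have hnorm : ∀ s : ℝ, 0 ≤ s → ‖Complex.exp (-(s : ℂ) / 2)‖ ≤ 1 := by
    intro s hs
    rw [Complex.norm_exp, Real.exp_le_one_iff]
    simp
    linarith
  have hh : ∀ (n : ℕ) a i, Measurable fun ω : HiddenWeights nin n =>
      hidden φ ω (x a) (ℓ + 2 - 1) i := fun n a i =>
    measurable_postActivation hφm
      (fun r i => (measurable_pi_apply r).comp ((measurable_pi_apply i).comp measurable_fst))
      (fun i j => (measurable_pi_apply (i, j)).comp measurable_snd) _ _ _
  -- The factor `σw²` built into the kernel cancels against the denominator of `(σv / σw)²`.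
  have hquad : (recVar σv * ∑ k, ∑ a, ∑ b, t (k, a) * t (k, b) *
        ∫ q, ψ a q * ψ b q ∂T.μ : ℝ) = t.ofLp ⬝ᵥ iidCov (nout := nout)
        (fun y y' => (σv / σw) ^ 2 * kernel φ σu σw (ℓ + 2) y y') x *ᵥ t.ofLp := by
    simp only [dotProduct, mulVec, iidCov, Fintype.sum_prod_type, hK, coe_recVar]
    rw [Finset.mul_sum]
    refine Finset.sum_congr rfl fun k _ => ?_
    rw [Finset.mul_sum]
    refine Finset.sum_congr rfl fun a _ => ?_
    rw [Finset.sum_eq_single k (fun k' _ hk' => by simp [Ne.symm hk']) (by simp), Finset.mul_sum,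
      Finset.mul_sum]
    refine Finset.sum_congr rfl fun b _ => ?_
    simp only [if_true]
    field_simp
  have hq0 : 0 ≤ t.ofLp ⬝ᵥ iidCov (nout := nout)
        (fun y y' => (σv / σw) ^ 2 * kernel φ σu σw (ℓ + 2) y y') x *ᵥ t.ofLp := by
    have := (posSemidef_iidCov_kernel (σu := σu) (nout := nout) hφm hφ hσw ℓ (σv / σw)
      x).dotProduct_mulVec_nonneg t.ofLp
    simpa using this
  rw [hquad] at hexp
  have hfin := tendsto_integral_of_highProb (fun n => ?_) (fun n ω => hnorm _ (hnn n ω))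
    (hnorm _ hq0) hexp
  · convert hfin using 2
    congr 1
    simp
    ring
  · have := hh n
    fun_prop

/-- The output is a measurable function of the weights, so its law depends only on theirs. This
replaces the given probability spaces by a canonical product. -/
lemma map_outputVector (hφm : Measurable φ) {Ω : Type*} [MeasurableSpace Ω] {P : Measure Ω}
    [IsProbabilityMeasure P] {U : Ω → Matrix (Fin nin) (Fin n) ℝ}
    {W : Ω → Matrix (Fin n) (Fin n) ℝ} {V : Ω → Matrix (Fin n) (Fin nout) ℝ} {σv : ℝ}
    (hinit : RandomInit P σu σw σv U W V) {m : ℕ} (L : ℕ)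
    (x : Fin m → EuclideanSpace ℝ (Fin nin)) :
    AEMeasurable (fun ω => outputVector φ (U ω) (W ω) (V ω) L x) P ∧
    P.map (fun ω => outputVector φ (U ω) (W ω) (V ω) L x) =
      (Measure.pi fun s => gaussianReal 0
        (weightVar (n := n) (inVar nin σu) (recVar σw) (recVar σv) s)).map
          (outputOfWeights φ L x) := by
  have hmeas : ∀ s, AEMeasurable (weightEntry U W V s) P := by
    rintro (p | p | p)
    · exact (hinit.law_U p.1 p.2).aemeasurable
    · exact (hinit.law_W p.1 p.2).aemeasurable
    · exact (hinit.law_V p.1 p.2).aemeasurable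
  have hdiv : ∀ σ : ℝ, (σ ^ 2 / n).toNNReal = recVar σ / n := by
    intro σ
    rw [Real.toNNReal_div (sq_nonneg _), Real.toNNReal_natCast]
    rfl
  have hvec : AEMeasurable (fun ω s => weightEntry U W V s ω) P :=
    aemeasurable_pi_lambda _ hmeas
  have hlaw : P.map (fun ω s => weightEntry U W V s ω) = Measure.pi fun s =>
      gaussianReal 0 (weightVar (n := n) (inVar nin σu) (recVar σw) (recVar σv) s) := by
    rw [(iIndepFun_iff_map_fun_eq_pi_map hmeas).1 hinit.indep]
    congr 1
    ext1 s
    rcases s with p | p | p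
    · exact (hinit.law_U p.1 p.2).map_eq
    · refine (hinit.law_W p.1 p.2).map_eq.trans ?_
      rw [hdiv]; rfl
    · refine (hinit.law_V p.1 p.2).map_eq.trans ?_
      rw [hdiv]; rfl
  have hG := measurable_outputOfWeights (n := n) (nout := nout) hφm L x
  refine ⟨hG.comp_aemeasurable hvec, ?_⟩
  rw [← hlaw, AEMeasurable.map_map_of_aemeasurable hG.aemeasurable hvec]
  rfl

end Output

end InputInjectionNet

/-! ### The infinite-width limit. -/

theorem theorem4p1 {nin nout : ℕ} (φ : ℝ → ℝ) (hφm : Measurable φ)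
    (hφ : InputInjectionNet.Controllable φ)
    (σu σw σv : ℝ) (hσu : 0 < σu) (hσw : 0 < σw) (hσv : 0 < σv)
    -- for every width `n`, a probability space carrying the random weights
    {Ω : ℕ → Type*} [∀ n, MeasurableSpace (Ω n)]
    (P : ∀ n, Measure (Ω n)) [∀ n, IsProbabilityMeasure (P n)]
    (U : ∀ n, Ω n → Matrix (Fin nin) (Fin n) ℝ)
    (W : ∀ n, Ω n → Matrix (Fin n) (Fin n) ℝ)
    (V : ∀ n, Ω n → Matrix (Fin n) (Fin nout) ℝ)
    (hinit : ∀ n, InputInjectionNet.RandomInit (P n) σu σw σv (U n) (W n) (V n))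
    (L : ℕ) (hL : 2 ≤ L) :
    -- the recursion for the covariance functions is well defined up to level `L`
    (∀ x x' : EuclideanSpace ℝ (Fin nin),
      (InputInjectionNet.pairCov (InputInjectionNet.inputKernel σu) x x').PosSemidef ∧
      Integrable (fun z : EuclideanSpace ℝ (Fin 2) => φ (z 0) * φ (z 1))
        (multivariateGaussian 0
          (InputInjectionNet.pairCov (InputInjectionNet.inputKernel σu) x x'))) ∧
    (∀ ℓ : ℕ, 2 ≤ ℓ → ℓ < L → ∀ x x' : EuclideanSpace ℝ (Fin nin),
      (InputInjectionNet.quadCov (InputInjectionNet.inputKernel σu)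
        (InputInjectionNet.kernel φ σu σw ℓ) x x').PosSemidef ∧
      Integrable (fun z : EuclideanSpace ℝ (Fin 4) => φ (z 1 + z 0) * φ (z 3 + z 2))
        (multivariateGaussian 0
          (InputInjectionNet.quadCov (InputInjectionNet.inputKernel σu)
            (InputInjectionNet.kernel φ σu σw ℓ) x x'))) ∧
    -- all joint finite-dimensional distributions converge to those of i.i.d. (over the output
    -- coordinate) centered Gaussian processes
    (∀ (m : ℕ) (x : Fin m → EuclideanSpace ℝ (Fin nin)),
      (InputInjectionNet.iidCov (nout := nout)
        (fun y y' => (σv / σw) ^ 2 * InputInjectionNet.kernel φ σu σw L y y') x).PosSemidef ∧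
      TendstoInDistribution
        (fun n ω => InputInjectionNet.outputVector φ (U n ω) (W n ω) (V n ω) L x)
        atTop id P
        (multivariateGaussian 0
          (InputInjectionNet.iidCov (nout := nout)
            (fun y y' => (σv / σw) ^ 2 * InputInjectionNet.kernel φ σu σw L y y') x))) := by
  obtain ⟨ℓ, rfl⟩ := Nat.exists_eq_add_of_le' hL
  refine ⟨fun x x' => ?_, fun k hk _ x x' => ?_, fun m x =>
    ⟨InputInjectionNet.posSemidef_iidCov_kernel hφm hφ hσw ℓ _ x, ?_⟩⟩
  · have h := InputInjectionNet.pairCov_gaussian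
      (InputInjectionNet.Stage.init nin (InputInjectionNet.inVar nin σu) 0) hφm hφ x x'
    exact ⟨h.1, h.2.1⟩
  · obtain ⟨j, rfl⟩ := Nat.exists_eq_add_of_le' hk
    exact InputInjectionNet.quadCov_kernel_gaussian hφm hφ hσw j x x'
  · have hout := fun n => InputInjectionNet.map_outputVector hφm (hinit n) (ℓ + 2) x
    refine ⟨fun n => (hout n).1, aemeasurable_id, ?_⟩
    -- Lévy's continuity theorem.
    refine ProbabilityMeasure.tendsto_of_tendsto_charFun fun t => ?_
    simp only [ProbabilityMeasure.coe_mk, Measure.map_id, fun n => (hout n).2]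
    exact InputInjectionNet.tendsto_charFun_output hφm hφ hσw ℓ x σv t
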